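/- Let $p$ be a prime, $\lambda\in\mathbb Z_p$ a $p$-adic unit, and $X$ a finite set with a chosen total order. For a commutative, not necessarily unital, $\mathbb Z_p$-algebra $A$ let $\mathrm{Sh}_\lambda(A)=\bigoplus_{n\ge 0}A^{\otimes n}$ be the mixable shuffle algebra of weight $\lambda$: the commutative $\mathbb Z_p$-algebra with unit $1\in A^{\otimes 0}=\mathbb Z_p$ whose bilinear product $*$ satisfies $$(a\otimes u)*(b\otimes v)=a\otimes\big(u*(b\otimes v)\big)+b\otimes\big((a\otimes u)*v\big)+\lambda\,(ab)\otimes(u*v)$$ for $a,b\in A$ and tensors $u,v$ (a scalar tensor factor being absorbed by scalar multiplication). For a commutative unital $\mathbb Z_p$-algebra $A$, the free commutative Rota–Baxter algebra of weight $\lambda$ on $A$ is, as an algebra, the tensor product $Ш_{\mathbb Z_p,\lambda}(A)=A\otimes\mathrm{Sh}_\lambda(A)$, with Rota–Baxter operator $P(a_0\otimes u)=1\otimes(a_0\otimes u)$. Let $S$ be the free abelian semigroup on $X$, that is, the set of non-constant monomials in $X$ under multiplication, ordered by total degree and then lexicographically by exponent vectors. Words in $S$ are the pure tensors $s_1\otimes\cdots\otimes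 s_r$ with $s_i\in S$, $r\ge 0$, ordered lexicographically (a proper prefix being smaller). A non-empty word $w$ is a Lyndon word if $w<v$ whenever $w=u\otimes v$ with $u,v$ non-empty. For $w=s_1\otimes\cdots\otimes s_r$ put $w^{\langle p\rangle}=s_1^p\otimes\cdots\otimes s_r^p$. Let $\mathrm{EL}$ be the set of Lyndon words $w$ such that $w=w^{\langle p\rangle}$ or $w$ is not of the form $u^{\langle p\rangle}$ for any word $u$, and let $\mathrm{TEL}=\{u^{\otimes p^i}: u\in\mathrm{EL},\ i\ge 0\}$. Then the homomorphism $\mathbb Z_p[X]\otimes\mathrm{Sh}_\lambda(\mathbb Z_pS)\to\mathbb Z_p[X]\otimes\mathrm{Sh}_\lambda(\mathbb Z_p[X])=Ш_{\mathbb Z_p,\lambda}(\mathbb Z_p[X])$ induced by the inclusion of the semigroup algebra $\mathbb Z_pS$ into $\mathbb Z_p[X]$ is injective, and its image, the canonical subalgebra, is isomorphic as a $\mathbb Z_p$-algebra to the polynomial algebra $\mathbb Z_p[X\sqcup\mathrm{TEL}]$, by an isomorphism sending the variable $x\in X$ to $x\otimes 1$ and the variable $w\in\mathrm{TEL}$ to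 $1\otimes w$. -/

import Mathlib

open scoped TensorProduct

noncomputable section

namespace MixSh

/- ## The tensor module with left concatenation -/

section Tensor

variable {k : Type*} [CommRing k] {A : Type*} [NonUnitalCommRing A] [Module k A]

/-- Left concatenation by a letter: `tcons a (a₁ ⊗ ⋯ ⊗ aₙ) = a ⊗ a₁ ⊗ ⋯ ⊗ aₙ`. -/
def tcons : A →ₗ[k] TensorAlgebra k A →ₗ[k] TensorAlgebra k A :=
  (LinearMap.mul k (TensorAlgebra k A)).comp (TensorAlgebra.ι k)

theorem tcons_apply (a : A) (u : TensorAlgebra k A) :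
    tcons a u = TensorAlgebra.ι k a * u := rfl

theorem tensor_induction {C : TensorAlgebra k A → Prop}
    (one : C 1) (cons : ∀ a u, C u → C (tcons a u))
    (add : ∀ u v, C u → C v → C (u + v)) (smul : ∀ (r : k) u, C u → C (r • u)) (u) : C u := by
  have key : ∀ x : TensorAlgebra k A, ∀ u, C u → C (x * u) := by
    intro x
    induction x using TensorAlgebra.induction with
    | algebraMap r => intro u hu; rw [← Algebra.smul_def]; exact smul r u hu
    | ι a => intro u hu; exact cons a u hu
    | mul x y hx hy => intro u hu; rw [mul_assoc]; exact hx _ (hy _ hu)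
    | add x y hx hy => intro u hu; rw [add_mul]; exact add _ _ (hx _ hu) (hy _ hu)
  simpa using key u 1 one

variable [IsScalarTower k A A] [SMulCommClass k A A] (lam : k)

/-- One step of the recursion on the second factor. Here `F` is multiplication by a tensor `u`, and
`g` stands for the product of `a ⊗ u` and `v`: the pair `(v, g)` is sent to `b ⊗ v` together
with `a ⊗ F (b ⊗ v) + b ⊗ g + lam (a b) ⊗ F v`. -/
def stepFun (a : A) (F : TensorAlgebra k A →ₗ[k] TensorAlgebra k A) :
    A →ₗ[k] Module.End k (TensorAlgebra k A × TensorAlgebra k A) :=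
  LinearMap.mk₂ k
    (fun (b : A) (x : TensorAlgebra k A × TensorAlgebra k A) =>
      (tcons b x.1,
        tcons a (F (tcons b x.1)) + tcons b x.2 + lam • tcons (a * b) (F x.1)))
    (fun b c x => by
      ext <;> simp only [map_add, LinearMap.add_apply, mul_add, smul_add, Prod.mk_add_mk]
      abel)
    (fun r b x => by
      ext <;> simp only [map_smul, LinearMap.smul_apply, mul_smul_comm, smul_add, Prod.smul_mk,
        smul_comm lam r])
    (fun b x y => by
      ext <;> simp only [map_add, Prod.fst_add, Prod.snd_add, smul_add, Prod.mk_add_mk]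
      abel)
    (fun r b x => by
      ext <;> simp only [map_smul, Prod.smul_fst, Prod.smul_snd, smul_add, Prod.smul_mk,
        smul_comm lam r])

theorem stepFun_apply (a : A) (F : TensorAlgebra k A →ₗ[k] TensorAlgebra k A) (b : A)
    (x : TensorAlgebra k A × TensorAlgebra k A) :
    stepFun lam a F b x =
      (tcons b x.1,
        tcons a (F (tcons b x.1)) + tcons b x.2 + lam • tcons (a * b) (F x.1)) := rfl

/-- If `F` is multiplication by `u`, then `consMulFun lam a F` is multiplication by `a ⊗ u`. -/
def consMulFun (a : A) (F : TensorAlgebra k A →ₗ[k] TensorAlgebra k A) :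
    TensorAlgebra k A →ₗ[k] TensorAlgebra k A :=
  (LinearMap.snd k _ _).comp
    ((LinearMap.applyₗ ((1 : TensorAlgebra k A), tcons a (F 1))).comp
      (TensorAlgebra.lift k (stepFun lam a F)).toLinearMap)

theorem consMulFun_one (a : A) (F : TensorAlgebra k A →ₗ[k] TensorAlgebra k A) :
    consMulFun lam a F 1 = tcons a (F 1) := by
  simp [consMulFun]

theorem consMulFun_fst (a : A) (F : TensorAlgebra k A →ₗ[k] TensorAlgebra k A)
    (v : TensorAlgebra k A) :
    (TensorAlgebra.lift k (stepFun lam a F) v (1, tcons a (F 1))).1 = v := by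
  induction v using tensor_induction with
  | one => simp
  | cons b v ih =>
    rw [tcons_apply b v, map_mul, TensorAlgebra.lift_ι_apply, Module.End.mul_apply, stepFun_apply,
      ih, tcons_apply]
  | add u v hu hv => simp [hu, hv]
  | smul r u hu => simp [hu]

theorem consMulFun_cons (a b : A) (F : TensorAlgebra k A →ₗ[k] TensorAlgebra k A)
    (v : TensorAlgebra k A) :
    consMulFun lam a F (tcons b v) =
      tcons a (F (tcons b v)) + tcons b (consMulFun lam a F v) + lam • tcons (a * b) (F v) := by
  have h := consMulFun_fst lam a F v
  simp only [consMulFun, LinearMap.comp_apply, AlgHom.toLinearMap_apply,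
    LinearMap.applyₗ_apply_apply, LinearMap.snd_apply]
  rw [tcons_apply b v, map_mul, TensorAlgebra.lift_ι_apply, Module.End.mul_apply]
  rw [stepFun_apply, h, ← tcons_apply]

/-- `consMulFun` as a bilinear map. -/
def consMul : A →ₗ[k] Module.End k (TensorAlgebra k A →ₗ[k] TensorAlgebra k A) :=
  LinearMap.mk₂ k (consMulFun lam)
    (fun a b F => by
      ext1 v
      induction v using tensor_induction with
      | one => simp [consMulFun_one]
      | cons c v ih =>
        simp only [LinearMap.add_apply] at ih
        simp only [LinearMap.add_apply, consMulFun_cons, ih, map_add, add_mul, smul_add]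
        abel
      | add u v hu hv => simp only [map_add, hu, hv]
      | smul r u hu => simp only [map_smul, hu])
    (fun s a F => by
      ext1 v
      induction v using tensor_induction with
      | one => simp [consMulFun_one]
      | cons c v ih =>
        simp only [LinearMap.smul_apply] at ih
        simp only [LinearMap.smul_apply, consMulFun_cons, ih, map_smul, smul_mul_assoc, smul_add,
          smul_comm lam s]
      | add u v hu hv => simp only [map_add, hu, hv]
      | smul r u hu => simp only [map_smul, hu])
    (fun a F G => by
      ext1 v
      induction v using tensor_induction with
      | one => simp [consMulFun_one]
      | cons c v ih =>
        simp only [LinearMap.add_apply] at ih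
        simp only [LinearMap.add_apply, consMulFun_cons, ih, map_add, smul_add]
        abel
      | add u v hu hv => simp only [map_add, hu, hv]
      | smul r u hu => simp only [map_smul, hu])
    (fun s a F => by
      ext1 v
      induction v using tensor_induction with
      | one => simp [consMulFun_one]
      | cons c v ih =>
        simp only [LinearMap.smul_apply] at ih
        simp only [LinearMap.smul_apply, consMulFun_cons, ih, map_smul, smul_add,
          smul_comm lam s]
      | add u v hu hv => simp only [map_add, hu, hv]
      | smul r u hu => simp only [map_smul, hu])

/-- The mixable shuffle product of weight `lam` on `k ⊕ A ⊕ A ⊗ A ⊕ ⋯`. It is characterised by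
`shMul_one_left`, `shMul_one_right` and `shMul_cons_cons` below. -/
def shMul : TensorAlgebra k A →ₗ[k] TensorAlgebra k A →ₗ[k] TensorAlgebra k A :=
  (LinearMap.applyₗ (LinearMap.id : TensorAlgebra k A →ₗ[k] TensorAlgebra k A)).comp
    (TensorAlgebra.lift k (consMul lam)).toLinearMap

theorem shMul_one_left (v : TensorAlgebra k A) : shMul lam 1 v = v := by
  simp [shMul]

theorem shMul_cons (a : A) (u : TensorAlgebra k A) :
    shMul lam (tcons a u) = consMulFun lam a (shMul lam u) := by
  simp [shMul, tcons_apply, consMul]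

theorem shMul_cons_cons (a b : A) (u v : TensorAlgebra k A) :
    shMul lam (tcons a u) (tcons b v) =
      tcons a (shMul lam u (tcons b v)) + tcons b (shMul lam (tcons a u) v) +
        lam • tcons (a * b) (shMul lam u v) := by
  rw [shMul_cons, consMulFun_cons]

theorem shMul_one_right (u : TensorAlgebra k A) : shMul lam u 1 = u := by
  induction u using tensor_induction with
  | one => exact shMul_one_left lam 1
  | cons a u ih => rw [shMul_cons, consMulFun_one, ih]
  | add u v hu hv => simp only [map_add, LinearMap.add_apply, hu, hv]
  | smul r u hu => simp only [map_smul, LinearMap.smul_apply, hu]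

theorem shMul_comm (u v : TensorAlgebra k A) : shMul lam u v = shMul lam v u := by
  induction u using tensor_induction generalizing v with
  | one => rw [shMul_one_left, shMul_one_right]
  | cons a u ihu =>
    induction v using tensor_induction with
    | one => rw [shMul_one_left, shMul_one_right]
    | cons b v ihv =>
      rw [shMul_cons_cons, shMul_cons_cons, ihv, ihu, ihu, mul_comm a b]
      abel
    | add v w hv hw => simp only [map_add, LinearMap.add_apply, hv, hw]
    | smul r v hv => simp only [map_smul, LinearMap.smul_apply, hv]
  | add u w hu hw => simp only [map_add, LinearMap.add_apply, hu, hw]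
  | smul r u hu => simp only [map_smul, LinearMap.smul_apply, hu]

theorem shMul_assoc (u v w : TensorAlgebra k A) :
    shMul lam (shMul lam u v) w = shMul lam u (shMul lam v w) := by
  induction u using tensor_induction generalizing v w with
  | one => simp only [shMul_one_left]
  | cons a u ihu =>
    induction v using tensor_induction generalizing w with
    | one => simp only [shMul_one_left, shMul_one_right]
    | cons b v ihv =>
      induction w using tensor_induction with
      | one => simp only [shMul_one_right]
      | cons c w ihw =>
        have e1 := shMul_cons_cons lam a b u v
        have e2 := shMul_cons_cons lam b c v w
        have l : shMul lam (shMul lam (tcons a u) (tcons b v)) (tcons c w) =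
            tcons a (shMul lam (shMul lam u (tcons b v)) (tcons c w)) +
            tcons b (shMul lam (shMul lam (tcons a u) v) (tcons c w)) +
            lam • tcons (a * b) (shMul lam (shMul lam u v) (tcons c w)) +
            tcons c (shMul lam (shMul lam (tcons a u) (tcons b v)) w) +
            lam • tcons (a * c) (shMul lam (shMul lam u (tcons b v)) w) +
            lam • tcons (b * c) (shMul lam (shMul lam (tcons a u) v) w) +
            lam • lam • tcons (a * b * c) (shMul lam (shMul lam u v) w) := by
          simp only [e1, map_add, map_smul, LinearMap.add_apply, LinearMap.smul_apply,
            shMul_cons_cons lam _ c, smul_add]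
          abel
        have r : shMul lam (tcons a u) (shMul lam (tcons b v) (tcons c w)) =
            tcons a (shMul lam u (shMul lam (tcons b v) (tcons c w))) +
            tcons b (shMul lam (tcons a u) (shMul lam v (tcons c w))) +
            lam • tcons (a * b) (shMul lam u (shMul lam v (tcons c w))) +
            tcons c (shMul lam (tcons a u) (shMul lam (tcons b v) w)) +
            lam • tcons (a * c) (shMul lam u (shMul lam (tcons b v) w)) +
            lam • tcons (b * c) (shMul lam (tcons a u) (shMul lam v w)) +
            lam • lam • tcons (a * b * c) (shMul lam u (shMul lam v w)) := by
          simp only [e2, map_add, map_smul, shMul_cons_cons lam a, smul_add, mul_assoc]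
          abel
        rw [l, r, ihw, ihu, ihu, ihu, ihu, ihv, ihv]
      | add w x hw hx => simp only [map_add, hw, hx]
      | smul r w hw => simp only [map_smul, hw]
    | add v x hv hx => simp only [map_add, LinearMap.add_apply, hv, hx]
    | smul r v hv => simp only [map_smul, LinearMap.smul_apply, hv]
  | add u x hu hx => simp only [map_add, LinearMap.add_apply, hu, hx]
  | smul r u hu => simp only [map_smul, LinearMap.smul_apply, hu]

end Tensor

/- ## Mixable shuffle algebras -/

/-- The underlying module `k ⊕ A ⊕ A ⊗ A ⊕ ⋯` of the mixable shuffle algebra `Sh k lam A` of weight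
`lam` generated by the commutative, not necessarily unital `k`-algebra `A`. -/
def Sh (k : Type*) [CommRing k] (_lam : k) (A : Type*) [NonUnitalCommRing A] [Module k A] :
    Type _ :=
  TensorAlgebra k A

section Sh

variable (k : Type*) [CommRing k] (lam : k) (A : Type*) [NonUnitalCommRing A] [Module k A]

instance : AddCommGroup (Sh k lam A) := inferInstanceAs (AddCommGroup (TensorAlgebra k A))

instance : Module k (Sh k lam A) := inferInstanceAs (Module k (TensorAlgebra k A))

variable {k A}

/-- Left concatenation by a letter, `a₁ ⊗ ⋯ ⊗ aₙ ↦ a ⊗ a₁ ⊗ ⋯ ⊗ aₙ`, on `Sh k lam A`. -/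
def Sh.cons : A →ₗ[k] Sh k lam A →ₗ[k] Sh k lam A := tcons

/-- The underlying linear map of `Sh.map`. -/
def Sh.mapLin {B : Type*} [NonUnitalCommRing B] [Module k B] (f : A →ₗ[k] B) :
    Sh k lam A →ₗ[k] Sh k lam B :=
  (TensorAlgebra.lift k ((TensorAlgebra.ι k).comp f)).toLinearMap

theorem Sh.mapLin_cons {B : Type*} [NonUnitalCommRing B] [Module k B] (f : A →ₗ[k] B)
    (a : A) (u : Sh k lam A) :
    Sh.mapLin lam f (Sh.cons lam a u) = Sh.cons lam (f a) (Sh.mapLin lam f u) := by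
  have h := map_mul (TensorAlgebra.lift k ((TensorAlgebra.ι k).comp f))
    (TensorAlgebra.ι k a) (show TensorAlgebra k A from u)
  rw [TensorAlgebra.lift_ι_apply] at h
  exact h

variable (k A)

variable [IsScalarTower k A A] [SMulCommClass k A A]

/-- Multiplication in `Sh k lam A` is the mixable shuffle product. -/
instance : CommRing (Sh k lam A) where
  one := (1 : TensorAlgebra k A)
  mul u v := shMul lam (A := A) u v
  left_distrib u v w := map_add (shMul lam (A := A) u) v w
  right_distrib u v w := LinearMap.map_add₂ (shMul lam (A := A)) u v w
  zero_mul u := LinearMap.map_zero₂ (shMul lam (A := A)) u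
  mul_zero u := map_zero (shMul lam (A := A) u)
  mul_assoc u v w := shMul_assoc (A := A) lam u v w
  one_mul u := shMul_one_left (A := A) lam u
  mul_one u := shMul_one_right (A := A) lam u
  mul_comm u v := shMul_comm (A := A) lam u v
  neg_add_cancel := neg_add_cancel
  zsmul := (· • ·)
  zsmul_zero' := SubNegMonoid.zsmul_zero'
  zsmul_succ' := SubNegMonoid.zsmul_succ'
  zsmul_neg' := SubNegMonoid.zsmul_neg'
  sub_eq_add_neg := sub_eq_add_neg

instance : Algebra k (Sh k lam A) :=
  Algebra.ofModule (fun r u v => LinearMap.map_smul₂ (shMul lam (A := A)) r u v)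
    (fun r u v => map_smul (shMul lam (A := A) u) r v)

variable {k A}

variable {lam}

theorem Sh.induction {C : Sh k lam A → Prop} (one : C 1) (cons : ∀ a u, C u → C (Sh.cons lam a u))
    (add : ∀ u v, C u → C v → C (u + v)) (smul : ∀ (r : k) u, C u → C (r • u)) (u) : C u :=
  tensor_induction (A := A) one cons add smul u

theorem Sh.cons_mul_cons (a b : A) (u v : Sh k lam A) :
    Sh.cons lam a u * Sh.cons lam b v =
      Sh.cons lam a (u * Sh.cons lam b v) + Sh.cons lam b (Sh.cons lam a u * v) +
        lam • Sh.cons lam (a * b) (u * v) :=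
  shMul_cons_cons lam a b u v

/-- The pure tensor `a₁ ⊗ ⋯ ⊗ aₙ` in `Sh k lam A`; the empty list gives `1`. -/
def Sh.tensor (lam : k) : List A → Sh k lam A
  | [] => 1
  | a :: l => Sh.cons lam a (Sh.tensor lam l)

/-- The algebra homomorphism `a₁ ⊗ ⋯ ⊗ aₙ ↦ f a₁ ⊗ ⋯ ⊗ f aₙ` of mixable shuffle algebras induced
by a homomorphism `f` of non-unital algebras. -/
def Sh.map (lam : k) {B : Type*} [NonUnitalCommRing B] [Module k B] [IsScalarTower k B B]
    [SMulCommClass k B B] (f : A →ₙₐ[k] B) : Sh k lam A →ₐ[k] Sh k lam B :=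
  AlgHom.ofLinearMap (Sh.mapLin lam (f : A →ₗ[k] B))
    (map_one (TensorAlgebra.lift k ((TensorAlgebra.ι k).comp (f : A →ₗ[k] B))))
    (fun u v => by
      have h1 : Sh.mapLin lam (f : A →ₗ[k] B) (1 : Sh k lam A) = 1 :=
        map_one (TensorAlgebra.lift k ((TensorAlgebra.ι k).comp (f : A →ₗ[k] B)))
      induction u using Sh.induction generalizing v with
      | one => rw [h1, one_mul, one_mul]
      | cons a u ihu =>
        induction v using Sh.induction with
        | one => rw [h1, mul_one, mul_one]
        | cons b v ihv =>
          simp only [Sh.cons_mul_cons, map_add, map_smul, Sh.mapLin_cons, ihu, ihv]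
          simp
        | add v w hv hw => simp only [map_add, mul_add, hv, hw]
        | smul r v hv => simp only [map_smul, mul_smul_comm, hv]
      | add u w hu hw => simp only [map_add, add_mul, hu, hw]
      | smul r u hu => simp only [map_smul, smul_mul_assoc, hu])

end Sh

/- ## Free commutative Rota-Baxter algebras -/

section Sha

variable (k : Type*) [CommRing k] (lam : k) (A : Type*) [CommRing A] [Algebra k A]

/-- The free commutative Rota-Baxter `k`-algebra of weight `lam` on the commutative `k`-algebra `A`:
the tensor product of algebras `A ⊗ Sh k lam A`. -/
abbrev Sha : Type _ := A ⊗[k] Sh k lam A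

/-- The Rota-Baxter operator `a₀ ⊗ (a₁ ⊗ ⋯ ⊗ aₙ) ↦ 1 ⊗ (a₀ ⊗ a₁ ⊗ ⋯ ⊗ aₙ)` of `Sha k lam A`. -/
def Sha.P : Sha k lam A →ₗ[k] Sha k lam A :=
  (TensorProduct.mk k A (Sh k lam A) 1).comp (TensorProduct.lift (Sh.cons lam))

theorem Sha.rotaBaxter (x y : Sha k lam A) :
    Sha.P k lam A x * Sha.P k lam A y =
      Sha.P k lam A (x * Sha.P k lam A y) + Sha.P k lam A (Sha.P k lam A x * y) +
        lam • Sha.P k lam A (x * y) := by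
  induction x using TensorProduct.induction_on with
  | zero => simp
  | tmul a u =>
    induction y using TensorProduct.induction_on with
    | zero => simp
    | tmul b v =>
      simp [Sha.P, Algebra.TensorProduct.tmul_mul_tmul, Sh.cons_mul_cons, TensorProduct.tmul_add]
    | add y z hy hz => simp only [map_add, mul_add, hy, hz, smul_add]; abel
  | add x z hx hz => simp only [map_add, add_mul, hx, hz, smul_add]; abel

end Sha

/- ## Free abelian semigroups and words -/

/-- The free abelian semigroup on `X`: the non-constant monomials in the elements of `X`, given by
their exponents. -/
@[ext]
structure FreeAbSemigroup (X : Type*) where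
  exps : X →₀ ℕ
  ne_zero : exps ≠ 0

namespace FreeAbSemigroup

variable {X : Type*}

theorem exps_injective : Function.Injective (exps : FreeAbSemigroup X → X →₀ ℕ) :=
  fun _ _ h => FreeAbSemigroup.ext h

instance : CommSemigroup (FreeAbSemigroup X) where
  mul s t := ⟨s.exps + t.exps, fun h => s.ne_zero (add_eq_zero.mp h).1⟩
  mul_assoc s t u := FreeAbSemigroup.ext (add_assoc s.exps t.exps u.exps)
  mul_comm s t := FreeAbSemigroup.ext (add_comm s.exps t.exps)

theorem exps_mul (s t : FreeAbSemigroup X) : (s * t).exps = s.exps + t.exps := rfl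

/-- The graded lexicographic order: first compare total degrees, then compare exponents
lexicographically with respect to the order of `X`. -/
instance [LinearOrder X] : LinearOrder (FreeAbSemigroup X) :=
  LinearOrder.lift' (fun s => toDegLex s.exps)
    (toDegLex_injective.comp exps_injective)

/-- The `p`-th power `s ^ p`, for a prime `p`. -/
def primePow (p : ℕ) [hp : Fact p.Prime] (s : FreeAbSemigroup X) : FreeAbSemigroup X :=
  ⟨p • s.exps, fun h => (smul_eq_zero.mp h).elim hp.out.ne_zero s.ne_zero⟩

/-- The inclusion of the semigroup algebra of the free abelian semigroup on `X` into the polynomial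
algebra in `X`, which is the algebra of the free abelian monoid on `X`. -/
def incl (k : Type*) [CommRing k] (X : Type*) :
    MonoidAlgebra k (FreeAbSemigroup X) →ₙₐ[k] MvPolynomial X k :=
  MonoidAlgebra.liftMagma k
    { toFun := fun s => MvPolynomial.monomial s.exps 1
      map_mul' := fun s t => by simp [exps_mul, MvPolynomial.monomial_mul] }

end FreeAbSemigroup

/- Words in `S` are lists of elements of `S`; tensor concatenation of words is `++`. -/

/-- A Lyndon word: a non-empty word `w` such that `w < v` in the lexicographic order whenever
`w = u ⊗ v` with `u` and `v` non-empty. -/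
def IsLyndon {S : Type*} [LinearOrder S] (w : List S) : Prop :=
  w ≠ [] ∧ ∀ u v : List S, u ≠ [] → v ≠ [] → w = u ++ v → List.Lex (· < ·) w v

/-- The operation sending a word `u₁ ⊗ ⋯ ⊗ uᵣ` to `u₁ ^ p ⊗ ⋯ ⊗ uᵣ ^ p`. -/
def wordPow (p : ℕ) [Fact p.Prime] {X : Type*} (w : List (FreeAbSemigroup X)) :
    List (FreeAbSemigroup X) :=
  w.map (FreeAbSemigroup.primePow p)

/-- The Lyndon words `w` such that either `w ^ ⟨p⟩ = w`, or `w` is not of the form `u ^ ⟨p⟩` for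
any word `u`. Here `u ^ ⟨p⟩` is `wordPow p u`. -/
def EL (p : ℕ) [Fact p.Prime] (X : Type*) [LinearOrder X] : Set (List (FreeAbSemigroup X)) :=
  {w | IsLyndon w ∧ (w = wordPow p w ∨ ∀ u, w ≠ wordPow p u)}

/-- The tensor powers `u ⊗ ⋯ ⊗ u` with `p ^ i` factors, `i ≥ 0`, of the words `u` in `EL p X`. -/
def TEL (p : ℕ) [Fact p.Prime] (X : Type*) [LinearOrder X] : Set (List (FreeAbSemigroup X)) :=
  {w | ∃ u ∈ EL p X, ∃ i : ℕ, w = (List.replicate (p ^ i) u).flatten}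

/-- The word `s₁ ⊗ ⋯ ⊗ sᵣ` on the free abelian semigroup, as a pure tensor of monomials in the
mixable shuffle algebra of `k[X]`. -/
def word {k : Type*} [CommRing k] (lam : k) {X : Type*} (w : List (FreeAbSemigroup X)) :
    Sh k lam (MvPolynomial X k) :=
  Sh.tensor lam (w.map fun s => MvPolynomial.monomial s.exps 1)

/-- The canonical homomorphism `k[X] ⊗ Sh k lam (k S) → k[X] ⊗ Sh k lam k[X] = Sha k lam k[X]`, for
the free abelian semigroup `S` on `X`, induced by the inclusion of `k S` into `k[X]`. -/
def canonicalMap (k : Type*) [CommRing k] (lam : k) (X : Type*) :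
    MvPolynomial X k ⊗[k] Sh k lam (MonoidAlgebra k (FreeAbSemigroup X)) →ₐ[k]
      Sha k lam (MvPolynomial X k) :=
  Algebra.TensorProduct.map (AlgHom.id k (MvPolynomial X k))
    (Sh.map lam (FreeAbSemigroup.incl k X))

/-- The canonical subalgebra `k[X] ⊗ Sh k lam (k S)` of `Sha k lam k[X]`. -/
def canonicalSubalgebra (k : Type*) [CommRing k] (lam : k) (X : Type*) :
    Subalgebra k (Sha k lam (MvPolynomial X k)) :=
  (canonicalMap k lam X).range

end MixSh

end

/-!
Write `S` for the free abelian semigroup on `X`. The projection of `k[X]` onto `k S` that drops the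
constant term is a linear retraction of the inclusion, so the canonical map is injective
(`canonicalMap_injective`). It remains to see that the homomorphism `telHom` from the polynomial
algebra on `TEL p X` to the mixable shuffle algebra of `k S` is bijective, for a local ring `k` with
`p` in its maximal ideal.

*Leading terms.* Every word is, in exactly one way, a non-increasing concatenation of Lyndon words
(the Chen-Fox-Lyndon factorization, `cfl`). Order words by length and then lexicographically. The
largest word in the product of `u` and `v` is the non-increasing concatenation of all the Lyndon
factors of `u` and `v` together, and its coefficient is a product of binomial coefficients, one for
each Lyndon word occurring (`wd_mul_wd_sub_mem`). This follows by induction from the recursion that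
defines the product, once one knows what a letter added on the left does to the factorization
(`topShuffle_cons_cons`).

*Powers.* In a Rota-Baxter algebra of weight `lam`,
`lam • (P x) ^ n = P ((P x + lam x) ^ n - (P x) ^ n)` for `n ≥ 1` (`Sha.smul_P_pow`). For `n = p`
this shows that the `p`-th power of a word `w` is modulo `p` a unit multiple of `w ^ ⟨p⟩`
(`wd_pow_prime`).

*Surjectivity.* By induction on the order, every word lies modulo `p` in the image of `telHom`
(`wd_mem_genFil`). A word with two different Lyndon factors is the leading term, with coefficient 1,
of a product of smaller words. A tensor power `l ⊗ ⋯ ⊗ l` with `n` factors, where `n` is not a power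
of `p`, is the leading term of the product of the powers with `p ^ i` and `n - p ^ i` factors, where
`p ^ i` is the largest power of `p` up to `n`; the coefficient is prime to `p` by Lucas' theorem. If
`n` is a power of `p`, the word is in `TEL p X`, or `l = u ^ ⟨p⟩` and the word is modulo `p` and up
to a unit the `p`-th power of a smaller one. Nakayama's lemma in bounded degree, where everything
is finitely generated since `X` is finite, gives surjectivity.

*Injectivity.* Sending `u ⊗ ⋯ ⊗ u`, with `p ^ i` factors, to the Lyndon word `u ^ ⟨p ^ i⟩` of the
same degree, and multisets of Lyndon words to words, embeds the monomials in `TEL p X` into the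
words of the same degree (`monomialWord`). So in bounded degree `telHom` is a surjection onto a
finite module from a module that embeds into it, hence injective by Orzech's theorem.
-/

noncomputable section

namespace MixSh

/-! ### Lexicographic comparison of words -/

section Lyndon

variable {α : Type*} [LinearOrder α]

/-- `DiffLt x y` says that `x < y` lexicographically because of a position at which both words have
a letter, and not because `x` is a proper prefix of `y`. -/
def DiffLt (x y : List α) : Prop :=
  ∃ (c : List α) (s t : α) (x' y' : List α), s < t ∧ x = c ++ s :: x' ∧ y = c ++ t :: y'

theorem DiffLt.append {x y : List α} (h : DiffLt x y) (z z' : List α) :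
    DiffLt (x ++ z) (y ++ z') := by
  obtain ⟨c, s, t, x', y', hst, rfl, rfl⟩ := h
  exact ⟨c, s, t, x' ++ z, y' ++ z', hst, by simp, by simp⟩

theorem DiffLt.append_left {x y : List α} (h : DiffLt x y) (z : List α) :
    DiffLt (z ++ x) (z ++ y) := by
  obtain ⟨c, s, t, x', y', hst, rfl, rfl⟩ := h
  exact ⟨z ++ c, s, t, x', y', hst, by simp, by simp⟩

theorem append_lt_append_left {x y : List α} (h : x < y) (z : List α) : z ++ x < z ++ y :=
  List.Lex.append_left _ h z

theorem DiffLt.lt {x y : List α} (h : DiffLt x y) : x < y := by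
  obtain ⟨c, s, t, x', y', hst, rfl, rfl⟩ := h
  exact append_lt_append_left (List.Lex.rel hst) c

theorem lt_append_of_ne_nil (x : List α) {r : List α} (hr : r ≠ []) : x < x ++ r := by
  obtain ⟨a, r, rfl⟩ := List.exists_cons_of_ne_nil hr
  have h := append_lt_append_left (x := []) (y := a :: r) List.Lex.nil x
  rwa [List.append_nil] at h

theorem le_append (x r : List α) : x ≤ x ++ r := by
  by_cases hr : r = []
  · simp [hr]
  · exact (lt_append_of_ne_nil x hr).le

theorem diffLt_or_prefix_of_lt {x y : List α} (h : x < y) : DiffLt x y ∨ x <+: y := by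
  induction x generalizing y with
  | nil => exact Or.inr List.nil_prefix
  | cons a x ih =>
    have h' : List.Lex (· < ·) (a :: x) y := h
    cases h' with
    | cons h' =>
      rcases ih h' with h' | h'
      · exact Or.inl (h'.append_left [a])
      · exact Or.inr (by simpa using h')
    | rel h' => exact Or.inl ⟨[], _, _, _, _, h', rfl, rfl⟩

theorem diffLt_of_lt_of_length_le {x y : List α} (h : x < y) (hl : y.length ≤ x.length) :
    DiffLt x y := by
  rcases diffLt_or_prefix_of_lt h with h' | h'
  · exact h'
  · exact absurd (h'.eq_of_length_le hl) h.ne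

/-! ### Lyndon words and the Chen-Fox-Lyndon factorization -/

theorem IsLyndon.lt {u v : List α} (h : IsLyndon (u ++ v)) (hu : u ≠ []) (hv : v ≠ []) :
    u ++ v < v :=
  h.2 u v hu hv rfl

theorem IsLyndon.diffLt {u v : List α} (h : IsLyndon (u ++ v)) (hu : u ≠ []) (hv : v ≠ []) :
    DiffLt (u ++ v) v :=
  diffLt_of_lt_of_length_le (h.lt hu hv) (by simp)

theorem isLyndon_singleton (a : α) : IsLyndon [a] := by
  refine ⟨by simp, fun u v hu hv h => ?_⟩
  have h' := congrArg List.length h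
  have := List.length_pos_iff.mpr hu
  have := List.length_pos_iff.mpr hv
  simp at h'
  omega

theorem IsLyndon.append {x l : List α} (hx : IsLyndon x) (hl : IsLyndon l) (h : x < l) :
    IsLyndon (x ++ l) := by
  have key : x ++ l < l := by
    rcases diffLt_or_prefix_of_lt h with h' | ⟨r, rfl⟩
    · simpa using (h'.append l []).lt
    · have hr : r ≠ [] := by rintro rfl; simp at h
      exact append_lt_append_left (hl.lt hx.1 hr) x
  refine ⟨by simp [hx.1], fun u v hu hv huv => ?_⟩
  change x ++ l < v
  rcases List.append_eq_append_iff.mp huv with ⟨c, rfl, rfl⟩ | ⟨c, rfl, rfl⟩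
  · by_cases hc : c = []
    · simpa [hc] using key
    · exact key.trans (hl.lt hc hv)
  · by_cases hc : c = []
    · simpa [hc] using key
    · exact ((hx.diffLt hu hc).append l l).lt

/-- Put the word `x` in front of a list of words, merging it with the first word of the list as long
as `x` is smaller than that word. -/
def push (x : List α) : List (List α) → List (List α)
  | [] => [x]
  | l :: ls => if x < l then push (x ++ l) ls else x :: l :: ls

/-- The Chen-Fox-Lyndon factorization of a word into a non-increasing sequence of Lyndon words. -/
def cfl : List α → List (List α)
  | [] => []
  | a :: u => push [a] (cfl u)

/-- A non-increasing sequence of Lyndon words. -/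
def IsLyndonSeq (ls : List (List α)) : Prop :=
  ls.Pairwise (· ≥ ·) ∧ ∀ l ∈ ls, IsLyndon l

/-- The merged word absorbs an initial segment `A` of the sequence and dominates the rest `R`. -/
theorem push_spec (x : List α) (hx : IsLyndon x) (ls : List (List α)) (hls : IsLyndonSeq ls) :
    ∃ A R, ls = A ++ R ∧ push x ls = (x ++ A.flatten) :: R ∧ IsLyndon (x ++ A.flatten) ∧
      ∀ r ∈ R, r ≤ x ++ A.flatten := by
  induction ls generalizing x with
  | nil => exact ⟨[], [], by simp [push, hx]⟩
  | cons l ls ih =>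
    have hs := List.pairwise_cons.mp hls.1
    have hl := hls.2 l (by simp)
    by_cases h : x < l
    · obtain ⟨A, R, h1, h2, h3, h4⟩ := ih (x ++ l) (hx.append hl h)
        ⟨hs.2, fun y hy => hls.2 y (by simp [hy])⟩
      refine ⟨l :: A, R, by simp [h1], by simp [push, h, h2], by simpa using h3, by simpa using h4⟩
    · refine ⟨[], l :: ls, by simp, by simp [push, h], by simpa using hx, ?_⟩
      intro r hr
      rw [List.flatten_nil, List.append_nil]
      rcases List.mem_cons.mp hr with rfl | hr
      · exact not_lt.mp h
      · exact (hs.1 r hr).trans (not_lt.mp h)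

theorem isLyndonSeq_cfl (w : List α) : IsLyndonSeq (cfl w) := by
  induction w with
  | nil => exact ⟨by simp [cfl], by simp [cfl]⟩
  | cons a u ih =>
    obtain ⟨A, R, h1, h2, h3, h4⟩ := push_spec [a] (isLyndon_singleton a) (cfl u) ih
    rw [h1] at ih
    rw [cfl, h2]
    refine ⟨List.pairwise_cons.mpr ⟨h4, (List.pairwise_append.mp ih.1).2.1⟩, ?_⟩
    intro l hl
    rcases List.mem_cons.mp hl with rfl | hl
    · exact h3
    · exact ih.2 l (by simp [hl])

/-- How the factorization changes when a letter is added on the left: the new letter absorbs the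
factors `A`, all of which are larger than the word `L` that results. -/
theorem cfl_cons (a : α) (u : List α) :
    ∃ A R, cfl u = A ++ R ∧ cfl (a :: u) = (a :: A.flatten) :: R ∧
      IsLyndon (a :: A.flatten) ∧ (∀ r ∈ R, r ≤ a :: A.flatten) ∧ ∀ x ∈ A, a :: A.flatten < x := by
  have hu := isLyndonSeq_cfl u
  obtain ⟨A, R, h1, h2, h3, h4⟩ := push_spec [a] (isLyndon_singleton a) (cfl u) hu
  refine ⟨A, R, h1, h2, h3, h4, fun x hx => ?_⟩
  rw [h1] at hu
  rcases List.eq_nil_or_concat A with rfl | ⟨A', z, rfl⟩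
  · simp at hx
  · have hz := hu.2 z (by simp)
    have hzx : z ≤ x := by
      have h := (List.pairwise_append.mp hu.1).1
      rw [List.concat_eq_append, List.pairwise_append] at h
      simp only [List.concat_eq_append, List.mem_append, List.mem_singleton] at hx
      rcases hx with hx | rfl
      · exact h.2.2 x hx z (by simp)
      · exact le_rfl
    have h5 : a :: (A'.concat z).flatten = (a :: A'.flatten) ++ z := by simp
    rw [List.singleton_append, h5] at h3
    rw [h5]
    exact (h3.lt (by simp) hz.1).trans_le hzx

theorem flatten_cfl (w : List α) : (cfl w).flatten = w := by
  induction w with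
  | nil => simp [cfl]
  | cons a u ih =>
    obtain ⟨A, R, h1, h2, -⟩ := cfl_cons a u
    rw [h1] at ih
    rw [h2, List.flatten_cons, List.cons_append, ← List.flatten_append, ih]

theorem exists_suffix_prefix_of_prefix_flatten {β : Type*} (ls : List (List β)) (r : List β)
    (hr : r ≠ []) (h : r <+: ls.flatten) : ∃ s, s ≠ [] ∧ s <:+ r ∧ ∃ l ∈ ls, s <+: l := by
  induction ls generalizing r with
  | nil => simp_all
  | cons l ls ih =>
    obtain ⟨t, ht⟩ := h
    rw [List.flatten_cons] at ht
    rcases List.append_eq_append_iff.mp ht with ⟨c, h1, -⟩ | ⟨c, rfl, h2⟩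
    · exact ⟨r, hr, List.suffix_rfl, l, by simp, ⟨c, h1.symm⟩⟩
    · by_cases hc : c = []
      · subst hc
        exact ⟨l, by simpa using hr, by simp, l, by simp, List.prefix_rfl⟩
      · obtain ⟨s, hs, h3, l', hl', h4⟩ := ih c hc ⟨t, h2.symm⟩
        exact ⟨s, hs, h3.trans (List.suffix_append l c), l', by simp [hl'], h4⟩

/-- If the first factor of one factorization were a proper prefix of the first factor `l'` of
another, a non-empty proper suffix of `l'` would be a prefix of a factor that is smaller
than `l'`. -/
theorem head_eq_of_append_flatten_eq {l l' : List α} {ls ls' : List (List α)}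
    (h : IsLyndonSeq (l :: ls)) (h' : IsLyndon l') (heq : l ++ ls.flatten = l' ++ ls'.flatten)
    (hlen : l.length ≤ l'.length) : l = l' := by
  rcases List.append_eq_append_iff.mp heq with ⟨c, rfl, h2⟩ | ⟨c, rfl, -⟩
  · by_contra hne
    have hc : c ≠ [] := by rintro rfl; simp at hne
    obtain ⟨s, hs, ⟨d, rfl⟩, m, hm, ⟨e, rfl⟩⟩ :=
      exists_suffix_prefix_of_prefix_flatten ls c hc ⟨_, h2.symm⟩
    have hl : l ≠ [] := (h.2 l (by simp)).1
    rw [← List.append_assoc] at h'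
    have h3 := h'.lt (by simp [hl]) hs
    have h4 : s ++ e ≤ l := (List.pairwise_cons.mp h.1).1 _ hm
    have h5 : l ≤ l ++ d ++ s := by rw [List.append_assoc]; exact le_append _ _
    exact absurd (h3.trans_le ((le_append s e).trans (h4.trans h5))) (lt_irrefl _)
  · have : c = [] := List.eq_nil_of_length_eq_zero (by rw [List.length_append] at hlen; omega)
    simp [this]

/-- Uniqueness of the Chen-Fox-Lyndon factorization. -/
theorem IsLyndonSeq.eq_of_flatten_eq {ls ls' : List (List α)} (h : IsLyndonSeq ls)
    (h' : IsLyndonSeq ls') (heq : ls.flatten = ls'.flatten) : ls = ls' := by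
  induction ls generalizing ls' with
  | nil =>
    cases ls' with
    | nil => rfl
    | cons l' ls' => exact absurd heq.symm (by simp [(h'.2 l' (by simp)).1])
  | cons l ls ih =>
    cases ls' with
    | nil => exact absurd heq (by simp [(h.2 l (by simp)).1])
    | cons l' ls' =>
      have heq' := heq
      rw [List.flatten_cons, List.flatten_cons] at heq
      have hll : l = l' := by
        rcases le_total l.length l'.length with hlen | hlen
        · exact head_eq_of_append_flatten_eq h (h'.2 l' (by simp)) heq hlen
        · exact (head_eq_of_append_flatten_eq h' (h.2 l (by simp)) heq.symm hlen).symm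
      subst hll
      rw [ih ⟨(List.pairwise_cons.mp h.1).2, fun y hy => h.2 y (by simp [hy])⟩
        ⟨(List.pairwise_cons.mp h'.1).2, fun y hy => h'.2 y (by simp [hy])⟩
        (List.append_cancel_left heq)]

/-- The multiset of Lyndon factors of a word. -/
def factors (w : List α) : Multiset (List α) := (cfl w : Multiset (List α))

/-- The concatenation, in non-increasing order, of a multiset of words. -/
def assemble (s : Multiset (List α)) : List α := (s.sort (· ≥ ·)).flatten

theorem isLyndon_of_mem_factors {w l : List α} (h : l ∈ factors w) : IsLyndon l :=
  (isLyndonSeq_cfl w).2 l h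

theorem assemble_factors (w : List α) : assemble (factors w) = w := by
  rw [assemble, factors, Multiset.coe_sort,
    List.mergeSort_eq_self _ (by simpa using (isLyndonSeq_cfl w).1), flatten_cfl]

theorem factors_assemble {s : Multiset (List α)} (h : ∀ l ∈ s, IsLyndon l) :
    factors (assemble s) = s := by
  have h1 : IsLyndonSeq (s.sort (· ≥ ·)) :=
    ⟨s.pairwise_sort (· ≥ ·), fun l hl => h l (by simpa using hl)⟩
  have h2 := (isLyndonSeq_cfl (assemble s)).eq_of_flatten_eq h1 (flatten_cfl _)
  rw [factors, h2, Multiset.sort_eq]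

theorem assemble_zero : assemble (0 : Multiset (List α)) = [] := by
  simp [assemble]

theorem assemble_cons {l : List α} {s : Multiset (List α)} (h : ∀ x ∈ s, x ≤ l) :
    assemble (l ::ₘ s) = l ++ assemble s := by
  rw [assemble, Multiset.sort_cons (r := (· ≥ ·)) _ _ h]
  rfl

theorem assemble_coe_add {A : List (List α)} {s : Multiset (List α)} (hA : A.Pairwise (· ≥ ·))
    (h : ∀ x ∈ A, ∀ y ∈ s, y ≤ x) :
    assemble ((A : Multiset (List α)) + s) = A.flatten ++ assemble s := by
  induction A with
  | nil => simp
  | cons a A ih =>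
    have hA' := List.pairwise_cons.mp hA
    rw [← Multiset.cons_coe, Multiset.cons_add, assemble_cons,
      ih hA'.2 (fun x hx => h x (by simp [hx]))]
    · simp
    · intro x hx
      rcases Multiset.mem_add.mp hx with hx | hx
      · exact hA'.1 x hx
      · exact h a (by simp) x hx

theorem assemble_replicate (n : ℕ) (l : List α) :
    assemble (Multiset.replicate n l) = (List.replicate n l).flatten := by
  induction n with
  | zero => simp [assemble_zero]
  | succ n ih =>
    rw [Multiset.replicate_succ, assemble_cons (fun x hx => (Multiset.eq_of_mem_replicate hx).le),
      ih, List.replicate_succ, List.flatten_cons]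

theorem length_assemble (s : Multiset (List α)) :
    (assemble s).length = (s.map List.length).sum := by
  rw [assemble, List.length_flatten, ← Multiset.sum_coe, ← Multiset.map_coe, Multiset.sort_eq]

/-- A letter on the left commutes with reassembling the factors if it absorbs no factor that ought
to come later. -/
theorem cons_assemble_eq {a : α} {A : List (List α)} {R T : Multiset (List α)}
    (hA : A.Pairwise (· ≥ ·)) (hL : ∀ x ∈ A, a :: A.flatten < x) (hR : ∀ r ∈ R, r ≤ a :: A.flatten)
    (hT : ∀ t ∈ T, t ≤ a :: A.flatten) :
    a :: assemble (↑A + (R + T)) = assemble ((a :: A.flatten) ::ₘ (R + T)) := by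
  have hRT : ∀ y ∈ (R + T : Multiset (List α)), y ≤ a :: A.flatten := by
    intro y hy
    rcases Multiset.mem_add.mp hy with hy | hy
    · exact hR y hy
    · exact hT y hy
  rw [assemble_cons hRT, assemble_coe_add hA (fun x hx y hy => (hRT y hy).trans (hL x hx).le),
    List.cons_append]

/-- If a Lyndon word `m` is larger than `q ++ z`, then `q ++ m < m` at a common position. -/
theorem IsLyndon.diffLt_append {q z m : List α} (hm : IsLyndon m) (hq : q ≠ []) (h : q ++ z < m) :
    DiffLt (q ++ m) m := by
  by_cases hp : q <+: m
  · obtain ⟨r, rfl⟩ := hp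
    have hr : r ≠ [] := by
      rintro rfl
      exact absurd h (not_lt.mpr (by simpa using le_append q z))
    exact (hm.diffLt hq hr).append_left q
  · rcases diffLt_or_prefix_of_lt ((le_append q z).trans_lt h) with h' | h'
    · simpa using h'.append m []
    · exact absurd h' hp

/-- A letter on the left of the assembled factors gives a smaller word than reassembling if the
word that it forms with the factors it absorbs ought to come after the factor `m`. -/
theorem cons_assemble_lt {a : α} {m : List α} {A : List (List α)} {R T : Multiset (List α)}
    (hA : A.Pairwise (· ≥ ·)) (hR : ∀ r ∈ R, r ≤ a :: A.flatten)
    (hm : IsLyndon m) (hT : ∀ t ∈ T, t ≤ m) (hlt : a :: A.flatten < m) :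
    a :: assemble (↑A + (R + m ::ₘ T)) < assemble ((a :: A.flatten) ::ₘ (R + m ::ₘ T)) := by
  -- `A₁` consists of the absorbed factors that precede `m` in the sorted sequence
  set A₁ := A.takeWhile (fun x => decide (m ≤ x)) with hA₁
  set A₂ := A.dropWhile (fun x => decide (m ≤ x)) with hA₂
  have hsplit : A₁ ++ A₂ = A := List.takeWhile_append_dropWhile
  have h1 : ∀ x ∈ A₁, m ≤ x := fun x hx => by simpa using List.mem_takeWhile_imp hx
  rw [← hsplit, List.pairwise_append] at hA
  have h2 : ∀ x ∈ A₂, x ≤ m := by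
    intro x hx
    obtain ⟨y, ys, hy⟩ := List.exists_cons_of_ne_nil (List.ne_nil_of_mem hx)
    have h3 : ¬ m ≤ y := by
      have := List.head?_dropWhile_not (fun x => decide (m ≤ x)) A
      rw [← hA₂, hy] at this
      simpa using this
    have h4 := hA.2.1
    rw [hy] at hx h4
    rcases List.mem_cons.mp hx with rfl | hx
    · exact (not_le.mp h3).le
    · exact ((List.pairwise_cons.mp h4).1 x hx).trans (not_le.mp h3).le
  have hRm : ∀ r ∈ R, r ≤ m := fun r hr => (hR r hr).trans hlt.le
  have h5 : ∀ y ∈ (↑A₂ + (R + T) : Multiset (List α)), y ≤ m := by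
    intro y hy
    simp only [Multiset.mem_add, Multiset.mem_coe] at hy
    rcases hy with hy | hy | hy
    · exact h2 y hy
    · exact hRm y hy
    · exact hT y hy
  have h6 : (↑A + (R + m ::ₘ T) : Multiset (List α)) = ↑A₁ + m ::ₘ (↑A₂ + (R + T)) := by
    rw [← hsplit, ← Multiset.coe_add, Multiset.add_cons, Multiset.add_cons, Multiset.add_cons,
      add_assoc]
  have h7 : assemble ((A : Multiset (List α)) + (R + m ::ₘ T)) = 
      A₁.flatten ++ (m ++ assemble ((A₂ : Multiset (List α)) + (R + T))) := by
    rw [h6, assemble_coe_add hA.1, assemble_cons h5]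
    intro x hx y hy
    rcases Multiset.mem_cons.mp hy with rfl | hy
    · exact h1 x hx
    · exact (h5 y hy).trans (h1 x hx)
  have h8 : assemble ((a :: A.flatten) ::ₘ (R + m ::ₘ T)) =
      m ++ assemble ((a :: A.flatten) ::ₘ (R + T)) := by
    rw [Multiset.add_cons, Multiset.cons_swap, assemble_cons]
    intro y hy
    simp only [Multiset.mem_add, Multiset.mem_cons] at hy
    rcases hy with rfl | hy | hy
    · exact hlt.le
    · exact hRm y hy
    · exact hT y hy
  have h9 : DiffLt (a :: A₁.flatten ++ m) m := by
    refine hm.diffLt_append (z := A₂.flatten) (by simp) ?_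
    rwa [List.cons_append, ← List.flatten_append, hsplit]
  rw [h7, h8]
  have h10 := (h9.append (assemble ((A₂ : Multiset (List α)) + (R + T)))
    (assemble ((a :: A.flatten) ::ₘ (R + T)))).lt
  simpa using h10

/-! ### Shuffle multiplicities -/

/-- The product of binomial coefficients which is the multiplicity of the largest word among the
shuffles of two words with multisets of Lyndon factors `s` and `t`. -/
def shuffleCoeff (s t : Multiset (List α)) : ℕ :=
  ∏ l ∈ (s + t).toFinset, (s.count l + t.count l).choose (s.count l)

theorem shuffleCoeff_eq_prod {s t : Multiset (List α)} {Z : Finset (List α)}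
    (h : (s + t).toFinset ⊆ Z) :
    shuffleCoeff s t = ∏ l ∈ Z, (s.count l + t.count l).choose (s.count l) := by
  refine Finset.prod_subset h fun l _ hl => ?_
  have : l ∉ s + t := by simpa using hl
  rw [Multiset.mem_add, not_or] at this
  simp [Multiset.count_eq_zero_of_notMem this.1, Multiset.count_eq_zero_of_notMem this.2]

theorem shuffleCoeff_comm (s t : Multiset (List α)) : shuffleCoeff s t = shuffleCoeff t s := by
  rw [shuffleCoeff, shuffleCoeff, add_comm s t]
  refine Finset.prod_congr rfl fun l _ => ?_
  rw [add_comm (t.count l), Nat.choose_symm_add]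

theorem shuffleCoeff_zero_left (t : Multiset (List α)) : shuffleCoeff 0 t = 1 := by
  simp [shuffleCoeff]

theorem shuffleCoeff_eq_one_of_disjoint {s t : Multiset (List α)} (h : Disjoint s t) :
    shuffleCoeff s t = 1 := by
  refine Finset.prod_eq_one fun l _ => ?_
  by_cases hs : l ∈ s
  · have ht : l ∉ t := fun ht => Multiset.disjoint_left.mp h hs ht
    simp [Multiset.count_eq_zero_of_notMem ht]
  · simp [Multiset.count_eq_zero_of_notMem hs]

theorem shuffleCoeff_replicate (l : List α) (m n : ℕ) :
    shuffleCoeff (Multiset.replicate m l) (Multiset.replicate n l) = (m + n).choose m := by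
  rw [shuffleCoeff_eq_prod (Z := {l})]
  · simp
  · intro x hx
    simp only [Multiset.mem_toFinset, Multiset.mem_add, Multiset.mem_replicate] at hx
    rcases hx with hx | hx <;> simp [hx.2]

/-- Absorbing larger factors on the left does not change the multiplicity as long as the factors on
the right are all smaller than the result. -/
theorem shuffleCoeff_absorb {L : List α} {A R T : Multiset (List α)} (hA : ∀ x ∈ A, L < x)
    (hT : ∀ t ∈ T, t < L) : shuffleCoeff (A + R) T = shuffleCoeff (L ::ₘ R) T := by
  have h1 : (A + R + T).toFinset ⊆ (L ::ₘ (A + R + T)).toFinset := by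
    intro x; simp; tauto
  have h2 : (L ::ₘ R + T).toFinset ⊆ (L ::ₘ (A + R + T)).toFinset := by
    intro x; simp; tauto
  rw [shuffleCoeff_eq_prod h1, shuffleCoeff_eq_prod h2]
  refine Finset.prod_congr rfl fun l _ => ?_
  rcases lt_or_ge l L with h | h
  · have : l ∉ A := fun h' => (h.trans (hA l h')).false
    simp [Multiset.count_eq_zero_of_notMem this, Multiset.count_cons_of_ne h.ne]
  · have : l ∉ T := fun h' => ((hT l h').trans_le h).false
    simp [Multiset.count_eq_zero_of_notMem this]

/-- Pascal's rule at the factor `L`; the other binomial coefficients agree. -/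
theorem shuffleCoeff_pascal {L : List α} {A R B T : Multiset (List α)} (hA : ∀ x ∈ A, L < x)
    (hB : ∀ x ∈ B, L < x) (hR : ∀ x ∈ R, x ≤ L) (hT : ∀ t ∈ T, t ≤ L) :
    shuffleCoeff (A + R) (L ::ₘ T) + shuffleCoeff (L ::ₘ R) (B + T) =
      shuffleCoeff (L ::ₘ R) (L ::ₘ T) := by
  set Z := (L ::ₘ (A + R + (B + T))).toFinset with hZ
  have hLZ : L ∈ Z := by simp [hZ]
  have h1 : (A + R + L ::ₘ T).toFinset ⊆ Z := by intro x; simp [hZ]; tauto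
  have h2 : (L ::ₘ R + (B + T)).toFinset ⊆ Z := by intro x; simp [hZ]; tauto
  have h3 : (L ::ₘ R + L ::ₘ T).toFinset ⊆ Z := by intro x; simp [hZ]; tauto
  have hLA : L ∉ A := fun h => (hA L h).false
  have hLB : L ∉ B := fun h => (hB L h).false
  rw [shuffleCoeff_eq_prod h1, shuffleCoeff_eq_prod h2, shuffleCoeff_eq_prod h3,
    ← Finset.mul_prod_erase Z _ hLZ, ← Finset.mul_prod_erase Z _ hLZ,
    ← Finset.mul_prod_erase Z _ hLZ]
  have e1 : ∏ l ∈ Z.erase L, ((A + R).count l + (L ::ₘ T).count l).choose ((A + R).count l) =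
      ∏ l ∈ Z.erase L, ((L ::ₘ R).count l + (L ::ₘ T).count l).choose ((L ::ₘ R).count l) := by
    refine Finset.prod_congr rfl fun l hl => ?_
    have hne := (Finset.mem_erase.mp hl).1
    rcases lt_or_gt_of_ne hne with h | h
    · have : l ∉ A := fun h' => (h.trans (hA l h')).false
      simp [Multiset.count_eq_zero_of_notMem this, Multiset.count_cons_of_ne hne]
    · have h4 : l ∉ T := fun h' => ((hT l h').trans_lt h).false
      simp [Multiset.count_eq_zero_of_notMem h4, Multiset.count_cons_of_ne hne]
  have e2 : ∏ l ∈ Z.erase L, ((L ::ₘ R).count l + (B + T).count l).choose ((L ::ₘ R).count l) =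
      ∏ l ∈ Z.erase L, ((L ::ₘ R).count l + (L ::ₘ T).count l).choose ((L ::ₘ R).count l) := by
    refine Finset.prod_congr rfl fun l hl => ?_
    have hne := (Finset.mem_erase.mp hl).1
    rcases lt_or_gt_of_ne hne with h | h
    · have : l ∉ B := fun h' => (h.trans (hB l h')).false
      simp [Multiset.count_eq_zero_of_notMem this, Multiset.count_cons_of_ne hne]
    · have h4 : l ∉ R := fun h' => ((hR l h').trans_lt h).false
      simp [Multiset.count_eq_zero_of_notMem h4, Multiset.count_cons_of_ne hne]
  rw [e1, e2, ← add_mul]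
  congr 1
  simp only [Multiset.count_add, Multiset.count_cons_self, Multiset.count_eq_zero_of_notMem hLA,
    Multiset.count_eq_zero_of_notMem hLB, zero_add]
  generalize R.count L = r
  generalize T.count L = t
  rw [show r + 1 + (t + 1) = (r + t + 1) + 1 by ring, Nat.choose_succ_succ,
    show r + (t + 1) = r + t + 1 by ring, show r + 1 + t = r + t + 1 by ring]

end Lyndon

/-! ### The largest shuffle of two words -/

section TopShuffle

variable {α : Type*} [LinearOrder α]

/-- The largest of the shuffles of two words: all Lyndon factors of both words, concatenated in
non-increasing order. -/
def topShuffle (u v : List α) : List α := assemble (factors u + factors v)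

/-- The number of ways in which `topShuffle u v` arises as a shuffle of `u` and `v`. -/
def topCoeff (u v : List α) : ℕ := shuffleCoeff (factors u) (factors v)

theorem topShuffle_comm (u v : List α) : topShuffle u v = topShuffle v u := by
  rw [topShuffle, topShuffle, add_comm]

theorem topCoeff_comm (u v : List α) : topCoeff u v = topCoeff v u :=
  shuffleCoeff_comm _ _

theorem factors_nil : factors ([] : List α) = 0 := rfl

theorem topShuffle_nil_left (v : List α) : topShuffle [] v = v := by
  rw [topShuffle, factors_nil, zero_add, assemble_factors]

theorem topCoeff_nil_left (v : List α) : topCoeff [] v = 1 := by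
  rw [topCoeff, factors_nil, shuffleCoeff_zero_left]

theorem length_eq_sum_factors (w : List α) : w.length = ((factors w).map List.length).sum := by
  rw [← length_assemble, assemble_factors]

theorem length_topShuffle (u v : List α) : (topShuffle u v).length = u.length + v.length := by
  rw [topShuffle, length_assemble, Multiset.map_add, Multiset.sum_add, ← length_eq_sum_factors,
    ← length_eq_sum_factors]

/-- A shuffle of `a ⊗ u` and `b ⊗ v` that attains the largest one starts with the word whose first
Lyndon factor is larger; when the first factors agree, it can start with either. -/
theorem topShuffle_cons_cons (a : α) (u : List α) (b : α) (v : List α) :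
    (a :: topShuffle u (b :: v) = topShuffle (a :: u) (b :: v) ∧
      b :: topShuffle (a :: u) v < topShuffle (a :: u) (b :: v) ∧
      topCoeff u (b :: v) = topCoeff (a :: u) (b :: v)) ∨
    (a :: topShuffle u (b :: v) < topShuffle (a :: u) (b :: v) ∧
      b :: topShuffle (a :: u) v = topShuffle (a :: u) (b :: v) ∧
      topCoeff (a :: u) v = topCoeff (a :: u) (b :: v)) ∨
    (a :: topShuffle u (b :: v) = topShuffle (a :: u) (b :: v) ∧
      b :: topShuffle (a :: u) v = topShuffle (a :: u) (b :: v) ∧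
      topCoeff u (b :: v) + topCoeff (a :: u) v = topCoeff (a :: u) (b :: v)) := by
  obtain ⟨A, R, hu, hau, hL, hR, hA⟩ := cfl_cons a u
  obtain ⟨B, T, hv, hbv, hM, hT, hB⟩ := cfl_cons b v
  have hAs : A.Pairwise (· ≥ ·) := by
    have h := (isLyndonSeq_cfl u).1
    rw [hu] at h
    exact (List.pairwise_append.mp h).1
  have hBs : B.Pairwise (· ≥ ·) := by
    have h := (isLyndonSeq_cfl v).1
    rw [hv] at h
    exact (List.pairwise_append.mp h).1
  have fu : factors u = (A : Multiset (List α)) + (R : Multiset (List α)) := by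
    rw [factors, hu, Multiset.coe_add]
  have fv : factors v = (B : Multiset (List α)) + (T : Multiset (List α)) := by
    rw [factors, hv, Multiset.coe_add]
  have fau : factors (a :: u) = (a :: A.flatten) ::ₘ (R : Multiset (List α)) := by
    rw [factors, hau, Multiset.cons_coe]
  have fbv : factors (b :: v) = (b :: B.flatten) ::ₘ (T : Multiset (List α)) := by
    rw [factors, hbv, Multiset.cons_coe]
  have hR' : ∀ r ∈ (R : Multiset (List α)), r ≤ a :: A.flatten := hR
  have hT' : ∀ r ∈ (T : Multiset (List α)), r ≤ b :: B.flatten := hT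
  have hRL : ∀ r ∈ (a :: A.flatten) ::ₘ (R : Multiset (List α)), r ≤ a :: A.flatten := by
    intro r hr
    rcases Multiset.mem_cons.mp hr with rfl | hr
    · exact le_rfl
    · exact hR r hr
  have hTM : ∀ r ∈ (b :: B.flatten) ::ₘ (T : Multiset (List α)), r ≤ b :: B.flatten := by
    intro r hr
    rcases Multiset.mem_cons.mp hr with rfl | hr
    · exact le_rfl
    · exact hT r hr
  have eqa : b :: B.flatten ≤ a :: A.flatten →
      a :: topShuffle u (b :: v) = topShuffle (a :: u) (b :: v) := by
    intro h
    rw [topShuffle, topShuffle, fu, fau, fbv, add_assoc, Multiset.cons_add]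
    exact cons_assemble_eq hAs hA hR' fun t ht => (hTM t ht).trans h
  have eqb : a :: A.flatten ≤ b :: B.flatten →
      b :: topShuffle (a :: u) v = topShuffle (a :: u) (b :: v) := by
    intro h
    rw [topShuffle_comm _ v, topShuffle_comm _ (b :: v), topShuffle, topShuffle, fv, fau, fbv,
      add_assoc, Multiset.cons_add]
    exact cons_assemble_eq hBs hB hT' fun t ht => (hRL t ht).trans h
  have lta : a :: A.flatten < b :: B.flatten →
      a :: topShuffle u (b :: v) < topShuffle (a :: u) (b :: v) := by
    intro h
    rw [topShuffle, topShuffle, fu, fau, fbv, add_assoc, Multiset.cons_add (a :: A.flatten)]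
    exact cons_assemble_lt hAs hR' hM hT' h
  have ltb : b :: B.flatten < a :: A.flatten →
      b :: topShuffle (a :: u) v < topShuffle (a :: u) (b :: v) := by
    intro h
    rw [topShuffle_comm _ v, topShuffle_comm _ (b :: v), topShuffle, topShuffle, fv, fau, fbv,
      add_assoc, Multiset.cons_add (b :: B.flatten)]
    exact cons_assemble_lt hBs hT' hL hR' h
  have cgt : b :: B.flatten < a :: A.flatten →
      topCoeff u (b :: v) = topCoeff (a :: u) (b :: v) := by
    intro h
    rw [topCoeff, topCoeff, fu, fau, fbv]
    exact shuffleCoeff_absorb hA fun t ht => (hTM t ht).trans_lt h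
  have clt : a :: A.flatten < b :: B.flatten →
      topCoeff (a :: u) v = topCoeff (a :: u) (b :: v) := by
    intro h
    rw [topCoeff_comm _ v, topCoeff_comm _ (b :: v), topCoeff, topCoeff, fv, fau, fbv]
    exact shuffleCoeff_absorb hB fun t ht => (hRL t ht).trans_lt h
  rcases lt_trichotomy (b :: B.flatten) (a :: A.flatten) with h | h | h
  · exact Or.inl ⟨eqa h.le, ltb h, cgt h⟩
  · refine Or.inr (Or.inr ⟨eqa h.le, eqb h.ge, ?_⟩)
    rw [topCoeff, topCoeff, topCoeff, fu, fv, fau, fbv]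
    rw [h] at hB hT' ⊢
    exact shuffleCoeff_pascal hA hB hR' hT'
  · exact Or.inr (Or.inl ⟨lta h, eqb h.le, clt h⟩)

/-- The total degree of a word, for a given degree of its letters. -/
def wordDeg {S : Type*} (δ : S → ℕ) (w : List S) : ℕ := (w.map δ).sum

section

variable {S : Type*} (δ : S → ℕ)

@[simp]
theorem wordDeg_nil : wordDeg δ [] = 0 := rfl

@[simp]
theorem wordDeg_cons (a : S) (u : List S) : wordDeg δ (a :: u) = δ a + wordDeg δ u := by
  simp [wordDeg]

theorem wordDeg_flatten (ls : List (List S)) :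
    wordDeg δ ls.flatten = (ls.map (wordDeg δ)).sum := by
  induction ls with
  | nil => simp
  | cons l ls ih =>
    rw [List.flatten_cons, List.map_cons, List.sum_cons, ← ih]
    simp [wordDeg]

end

theorem wordDeg_assemble (δ : α → ℕ) (s : Multiset (List α)) :
    wordDeg δ (assemble s) = (s.map (wordDeg δ)).sum := by
  rw [assemble, wordDeg_flatten, ← Multiset.sum_coe, ← Multiset.map_coe, Multiset.sort_eq]

theorem wordDeg_topShuffle (δ : α → ℕ) (u v : List α) :
    wordDeg δ (topShuffle u v) = wordDeg δ u + wordDeg δ v := by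
  rw [topShuffle, wordDeg_assemble, Multiset.map_add, Multiset.sum_add, ← wordDeg_assemble,
    ← wordDeg_assemble, assemble_factors, assemble_factors]

end TopShuffle

/-! ### Words in the mixable shuffle algebra of a semigroup algebra -/

section Words

variable (k : Type*) [CommRing k] (lam : k) {S : Type*} [CommSemigroup S]

/-- A word in `S`, as a pure tensor in the mixable shuffle algebra of the semigroup algebra. -/
def wd (w : List S) : Sh k lam (MonoidAlgebra k S) :=
  Sh.tensor lam (w.map fun s => MonoidAlgebra.single s (1 : k))

theorem wd_nil : wd k lam ([] : List S) = 1 := rfl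

theorem wd_cons (a : S) (u : List S) :
    wd k lam (a :: u) = Sh.cons lam (MonoidAlgebra.single a (1 : k)) (wd k lam u) := rfl

theorem wd_cons_mul_wd_cons (a b : S) (u v : List S) :
    wd k lam (a :: u) * wd k lam (b :: v) =
      Sh.cons lam (MonoidAlgebra.single a 1) (wd k lam u * wd k lam (b :: v)) +
      Sh.cons lam (MonoidAlgebra.single b 1) (wd k lam (a :: u) * wd k lam v) +
      lam • Sh.cons lam (MonoidAlgebra.single (a * b) 1) (wd k lam u * wd k lam v) := by
  rw [wd_cons, wd_cons, Sh.cons_mul_cons, MonoidAlgebra.single_mul_single, one_mul]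

/-- The span of a set of words. -/
def wdSpan (Z : Set (List S)) : Submodule k (Sh k lam (MonoidAlgebra k S)) :=
  Submodule.span k (wd k lam '' Z)

variable {k lam}

theorem wd_mem_wdSpan {Z : Set (List S)} {w : List S} (h : w ∈ Z) : wd k lam w ∈ wdSpan k lam Z :=
  Submodule.subset_span ⟨w, h, rfl⟩

theorem wdSpan_mono {Z Z' : Set (List S)} (h : Z ⊆ Z') : wdSpan k lam Z ≤ wdSpan k lam Z' :=
  Submodule.span_mono (Set.image_mono h)

theorem cons_mem_wdSpan {Z Z' : Set (List S)} {a : S} (h : ∀ z ∈ Z, a :: z ∈ Z')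
    {x : Sh k lam (MonoidAlgebra k S)} (hx : x ∈ wdSpan k lam Z) :
    Sh.cons lam (MonoidAlgebra.single a 1) x ∈ wdSpan k lam Z' := by
  have h1 : wdSpan k lam Z ≤
      (wdSpan k lam Z').comap (Sh.cons lam (MonoidAlgebra.single a (1 : k))) := by
    refine Submodule.span_le.mpr ?_
    rintro _ ⟨z, hz, rfl⟩
    exact wd_mem_wdSpan (k := k) (lam := lam) (h z hz)
  exact h1 hx

theorem wdSpan_univ : wdSpan k lam (Set.univ : Set (List S)) = ⊤ := by
  refine Submodule.eq_top_iff'.mpr fun x => ?_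
  induction x using Sh.induction with
  | one => exact wd_mem_wdSpan (w := []) trivial
  | cons a u ih =>
    induction a using MonoidAlgebra.induction_linear with
    | zero => simp
    | add f g hf hg => rw [map_add, LinearMap.add_apply]; exact add_mem hf hg
    | single s r =>
      have : MonoidAlgebra.single s r = r • MonoidAlgebra.single s (1 : k) := by simp
      rw [this, map_smul, LinearMap.smul_apply]
      exact Submodule.smul_mem _ _ (cons_mem_wdSpan (Z := Set.univ) (Z' := Set.univ)
        (fun _ _ => trivial) ih)
  | add u v hu hv => exact add_mem hu hv
  | smul r u hu => exact Submodule.smul_mem _ _ hu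

variable (k lam S) in
/-- Reading off the coefficients of words. -/
def wdCoeff : Sh k lam (MonoidAlgebra k S) →ₗ[k] (List S →₀ k) :=
  (LinearMap.applyₗ (Finsupp.single ([] : List S) (1 : k))).comp
    (TensorAlgebra.lift k (A := Module.End k (List S →₀ k))
      ((Finsupp.lsum k fun s : S => LinearMap.toSpanSingleton k (Module.End k (List S →₀ k))
        (Finsupp.lmapDomain k k (List.cons s))).comp
          (MonoidAlgebra.coeffLinearEquiv k).toLinearMap)).toLinearMap

theorem wdCoeff_one : wdCoeff k lam S 1 = Finsupp.single [] 1 := by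
  have h := map_one (TensorAlgebra.lift k (A := Module.End k (List S →₀ k))
      ((Finsupp.lsum k fun s : S => LinearMap.toSpanSingleton k (Module.End k (List S →₀ k))
        (Finsupp.lmapDomain k k (List.cons s))).comp
          (MonoidAlgebra.coeffLinearEquiv k).toLinearMap))
  exact congrArg (fun f => f (Finsupp.single ([] : List S) (1 : k))) h

theorem wdCoeff_cons (a : S) (x : Sh k lam (MonoidAlgebra k S)) :
    wdCoeff k lam S (Sh.cons lam (MonoidAlgebra.single a 1) x) =
      Finsupp.mapDomain (List.cons a) (wdCoeff k lam S x) := by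
  have h := map_mul (TensorAlgebra.lift k (A := Module.End k (List S →₀ k))
      ((Finsupp.lsum k fun s : S => LinearMap.toSpanSingleton k (Module.End k (List S →₀ k))
        (Finsupp.lmapDomain k k (List.cons s))).comp
          (MonoidAlgebra.coeffLinearEquiv k).toLinearMap))
    (TensorAlgebra.ι k (MonoidAlgebra.single a (1 : k)))
    (show TensorAlgebra k (MonoidAlgebra k S) from x)
  rw [TensorAlgebra.lift_ι_apply] at h
  refine (congrArg (fun f => f (Finsupp.single ([] : List S) (1 : k))) h).trans ?_
  simp [wdCoeff]
  rfl

theorem wdCoeff_wd (w : List S) : wdCoeff k lam S (wd k lam w) = Finsupp.single w 1 := by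
  induction w with
  | nil => exact wdCoeff_one
  | cons a u ih => rw [wd_cons, wdCoeff_cons, ih, Finsupp.mapDomain_single]

variable (k lam S) in
/-- The words form a basis of the mixable shuffle algebra of the semigroup algebra. -/
def wdBasis : Module.Basis (List S) k (Sh k lam (MonoidAlgebra k S)) :=
  Module.Basis.mk (v := wd k lam)
    (LinearIndependent.of_comp (wdCoeff k lam S) (by
      have : wdCoeff k lam S ∘ wd k lam = fun w : List S => Finsupp.single w (1 : k) :=
        funext wdCoeff_wd
      rw [this]
      exact Finsupp.linearIndependent_single_one k (List S)))
    (by rw [← wdSpan_univ, wdSpan, Set.image_univ])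

theorem wdBasis_apply (w : List S) : wdBasis k lam S w = wd k lam w := by
  simp [wdBasis]

theorem wd_mul_wd_mem {δ : S → ℕ} (hδ : ∀ s t, δ (s * t) = δ s + δ t) (u v : List S) :
    wd k lam u * wd k lam v ∈ wdSpan k lam
      {z | z.length ≤ u.length + v.length ∧ wordDeg δ z = wordDeg δ u + wordDeg δ v} := by
  induction u generalizing v with
  | nil => rw [wd_nil, one_mul]; exact wd_mem_wdSpan (by simp)
  | cons a u ihu =>
    induction v with
    | nil => rw [wd_nil, mul_one]; exact wd_mem_wdSpan (by simp)
    | cons b v ihv =>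
      rw [wd_cons_mul_wd_cons]
      refine add_mem (add_mem ?_ ?_) (Submodule.smul_mem _ _ ?_)
      · refine cons_mem_wdSpan ?_ (ihu (b :: v))
        rintro z ⟨h1, h2⟩
        simp only [Set.mem_ofPred_eq, List.length_cons, wordDeg_cons] at *
        omega
      · refine cons_mem_wdSpan ?_ ihv
        rintro z ⟨h1, h2⟩
        simp only [Set.mem_ofPred_eq, List.length_cons, wordDeg_cons] at *
        omega
      · refine cons_mem_wdSpan ?_ (ihu v)
        rintro z ⟨h1, h2⟩
        simp only [Set.mem_ofPred_eq, List.length_cons, wordDeg_cons, hδ] at *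
        omega

variable [LinearOrder S]

/-- The words of the same degree as `w` that precede `w` when words are compared by length and then
lexicographically. -/
def lowerWords {α : Type*} [LinearOrder α] (δ : α → ℕ) (w : List α) : Set (List α) :=
  {z | List.Shortlex (· < ·) z w ∧ wordDeg δ z = wordDeg δ w}

theorem cons_mem_lowerWords {α : Type*} [LinearOrder α] {δ : α → ℕ} {a : α} {z w w' : List α}
    (hz : z ∈ lowerWords δ w) (hle : a :: w ≤ w') (hlen : (a :: w).length = w'.length)
    (hdeg : wordDeg δ (a :: w) = wordDeg δ w') : a :: z ∈ lowerWords δ w' := by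
  obtain ⟨h1, h2⟩ := hz
  refine ⟨?_, by rw [← hdeg, wordDeg_cons, wordDeg_cons, h2]⟩
  rcases List.shortlex_def.mp h1 with h | ⟨h, h'⟩
  · exact List.Shortlex.of_length_lt (by rw [← hlen]; simpa using h)
  · refine List.Shortlex.of_lex (by rw [← hlen]; simpa using h) ?_
    have h3 : a :: z < a :: w := List.Lex.cons h'
    exact (h3.trans_le hle : a :: z < w')

/-- The leading term of the product of two words. The shuffles of full length are estimated by
induction through `topShuffle_cons_cons`; all the other terms are shorter. -/
theorem wd_mul_wd_sub_mem {δ : S → ℕ} (hδ : ∀ s t, δ (s * t) = δ s + δ t) (u v : List S) :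
    wd k lam u * wd k lam v - (topCoeff u v : k) • wd k lam (topShuffle u v) ∈
      wdSpan k lam (lowerWords δ (topShuffle u v)) := by
  induction u generalizing v with
  | nil => simp [wd_nil, topCoeff_nil_left, topShuffle_nil_left]
  | cons a u ihu =>
    induction v with
    | nil =>
      rw [topCoeff_comm, topShuffle_comm]
      simp [wd_nil, topCoeff_nil_left, topShuffle_nil_left]
    | cons b v ihv =>
      set W := topShuffle (a :: u) (b :: v) with hW
      have la : (a :: topShuffle u (b :: v)).length = W.length := by
        simp only [hW, length_topShuffle, List.length_cons]; omega
      have lb : (b :: topShuffle (a :: u) v).length = W.length := by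
        simp only [hW, length_topShuffle, List.length_cons]; omega
      have da : wordDeg δ (a :: topShuffle u (b :: v)) = wordDeg δ W := by
        simp only [hW, wordDeg_topShuffle, wordDeg_cons]; omega
      have db : wordDeg δ (b :: topShuffle (a :: u) v) = wordDeg δ W := by
        simp only [hW, wordDeg_topShuffle, wordDeg_cons]; omega
      have ta : a :: topShuffle u (b :: v) ≤ W →
          Sh.cons lam (MonoidAlgebra.single a 1) (wd k lam u * wd k lam (b :: v)) -
            (topCoeff u (b :: v) : k) • wd k lam (a :: topShuffle u (b :: v)) ∈
            wdSpan k lam (lowerWords δ W) := by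
        intro h
        have := cons_mem_wdSpan (fun z hz => cons_mem_lowerWords hz h la da) (ihu (b :: v))
        rwa [map_sub, map_smul] at this
      have tb : b :: topShuffle (a :: u) v ≤ W →
          Sh.cons lam (MonoidAlgebra.single b 1) (wd k lam (a :: u) * wd k lam v) -
            (topCoeff (a :: u) v : k) • wd k lam (b :: topShuffle (a :: u) v) ∈
            wdSpan k lam (lowerWords δ W) := by
        intro h
        have := cons_mem_wdSpan (fun z hz => cons_mem_lowerWords hz h lb db) ihv
        rwa [map_sub, map_smul] at this
      have tc : lam • Sh.cons lam (MonoidAlgebra.single (a * b) 1) (wd k lam u * wd k lam v) ∈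
          wdSpan k lam (lowerWords δ W) := by
        refine Submodule.smul_mem _ _ (cons_mem_wdSpan ?_ (wd_mul_wd_mem hδ u v))
        rintro z ⟨h1, h2⟩
        refine ⟨List.Shortlex.of_length_lt ?_, ?_⟩
        · simp only [hW, length_topShuffle, List.length_cons]; omega
        · simp only [hW, wordDeg_topShuffle, wordDeg_cons, hδ]; omega
      have lta : a :: topShuffle u (b :: v) < W →
          wd k lam (a :: topShuffle u (b :: v)) ∈ wdSpan k lam (lowerWords δ W) :=
        fun h => wd_mem_wdSpan ⟨List.Shortlex.of_lex la h, da⟩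
      have ltb : b :: topShuffle (a :: u) v < W →
          wd k lam (b :: topShuffle (a :: u) v) ∈ wdSpan k lam (lowerWords δ W) :=
        fun h => wd_mem_wdSpan ⟨List.Shortlex.of_lex lb h, db⟩
      rw [wd_cons_mul_wd_cons]
      rcases topShuffle_cons_cons a u b v with ⟨h1, h2, h3⟩ | ⟨h1, h2, h3⟩ | ⟨h1, h2, h3⟩
      · have hb := Submodule.smul_mem _ (topCoeff (a :: u) v : k) (ltb h2)
        have h := add_mem (add_mem (add_mem (ta h1.le) (tb h2.le)) hb) tc
        rw [h1, h3] at h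
        convert h using 1
        abel
      · have ha := Submodule.smul_mem _ (topCoeff u (b :: v) : k) (lta h1)
        have h := add_mem (add_mem (add_mem (ta h1.le) (tb h2.le)) ha) tc
        rw [h2, h3] at h
        convert h using 1
        abel
      · have h := add_mem (add_mem (ta h1.le) (tb h2.le)) tc
        rw [h1, h2] at h
        rw [← h3, Nat.cast_add, add_smul]
        convert h using 1
        abel

end Words

/-! ### Prime powers in mixable shuffle algebras -/

section Frobenius

variable {k : Type*} [CommRing k] {lam : k} {A : Type*} [CommRing A] [Algebra k A]

/-- Powers of values of the Rota-Baxter operator. The identity follows by induction from the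
Rota-Baxter relation for the elements `(P x + lam x) ^ n - (P x) ^ n` and `x`. -/
theorem Sha.smul_P_pow (x : Sha k lam A) (n : ℕ) :
    lam • Sha.P k lam A x ^ (n + 1) =
      Sha.P k lam A ((Sha.P k lam A x + lam • x) ^ (n + 1) - Sha.P k lam A x ^ (n + 1)) := by
  induction n with
  | zero => simp
  | succ n ih =>
    rw [pow_succ (Sha.P k lam A x) (n + 1), ← smul_mul_assoc, ih, Sha.rotaBaxter, ← ih,
      ← map_smul, ← map_add, ← map_add]
    congr 1
    simp only [smul_mul_assoc, pow_succ, mul_add, sub_mul, smul_sub, mul_smul_comm]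
    abel

/-- Up to multiples of `p`, the `p`-th power of a tensor is computed on its factors. -/
theorem Sh.cons_pow_prime (ε : A →ₐ[k] k) {p : ℕ} (hp : p.Prime) (hlam : IsUnit lam) (a : A)
    (u : Sh k lam A) :
    ∃ y, Sh.cons lam a u ^ p = lam ^ (p - 1) • Sh.cons lam (a ^ p) (u ^ p) + (p : k) • y := by
  -- the augmentation `ε` turns an identity in `A ⊗ Sh k lam A` into one in `Sh k lam A`
  let π : Sha k lam A →ₐ[k] Sh k lam A :=
    Algebra.TensorProduct.lift ((Algebra.ofId k (Sh k lam A)).comp ε) (AlgHom.id k _)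
      fun _ _ => Commute.all _ _
  have hπ : ∀ v : Sh k lam A, π (1 ⊗ₜ v) = v := fun v => by simp [π]
  have hP : ∀ (b : A) (v : Sh k lam A), Sha.P k lam A (b ⊗ₜ v) = 1 ⊗ₜ Sh.cons lam b v :=
    fun b v => by simp [Sha.P]
  obtain ⟨r, hr⟩ := exists_add_pow_prime_eq hp (Sha.P k lam A (a ⊗ₜ u))
    (lam • (a ⊗ₜ[k] u : Sha k lam A))
  -- the Rota-Baxter identity for `n = p`, where the mixed terms of the `p`-th power are `p • z`
  set z := Sha.P k lam A (a ⊗ₜ u) * (lam • (a ⊗ₜ[k] u : Sha k lam A)) * r with hz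
  have h1 := Sha.smul_P_pow (lam := lam) (a ⊗ₜ[k] u : Sha k lam A) (p - 1)
  rw [Nat.sub_add_cancel hp.one_le, hr] at h1
  have h2 : Sha.P k lam A (a ⊗ₜ u) ^ p + (lam • (a ⊗ₜ[k] u : Sha k lam A)) ^ p +
      (p : Sha k lam A) * Sha.P k lam A (a ⊗ₜ u) * (lam • (a ⊗ₜ[k] u : Sha k lam A)) * r -
      Sha.P k lam A (a ⊗ₜ u) ^ p =
      lam ^ p • ((a ^ p) ⊗ₜ[k] (u ^ p) : Sha k lam A) + (p : k) • z := by
    have h3 : (p : k) • z = (p : Sha k lam A) * z := by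
      rw [Nat.cast_smul_eq_nsmul, nsmul_eq_mul]
    rw [h3, smul_pow, Algebra.TensorProduct.tmul_pow, hz]
    ring
  rw [h2, map_add, map_smul, map_smul, hP, hP] at h1
  have h4 := congrArg π h1
  rw [map_smul, map_pow, hπ, map_add, map_smul, map_smul, hπ] at h4
  obtain ⟨l, rfl⟩ := hlam
  refine ⟨(↑l⁻¹ : k) • π (Sha.P k (↑l) A z), ?_⟩
  have h5 := congrArg (fun x => (↑l⁻¹ : k) • x) h4
  simp only [smul_smul, smul_add, Units.inv_mul, one_smul] at h5
  rw [h5, smul_smul, mul_comm (p : k)]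
  congr 2
  obtain ⟨q, rfl⟩ : ∃ q, p = q + 1 := ⟨p - 1, (Nat.sub_add_cancel hp.one_le).symm⟩
  rw [pow_succ', ← mul_assoc, Units.inv_mul, one_mul, Nat.add_sub_cancel]

variable {X : Type*}

theorem word_pow_prime (p : ℕ) [hp : Fact p.Prime] (hlam : IsUnit lam)
    (w : List (FreeAbSemigroup X)) :
    ∃ (c : k) (y : Sh k lam (MvPolynomial X k)), IsUnit c ∧
      word lam w ^ p = c • word lam (wordPow p w) + (p : k) • y := by
  induction w with
  | nil => exact ⟨1, 0, isUnit_one, by simp [word, wordPow, Sh.tensor]⟩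
  | cons s w ih =>
    obtain ⟨c, y, hc, h⟩ := ih
    have hcons : ∀ (t : FreeAbSemigroup X) (v : List (FreeAbSemigroup X)),
        word lam (t :: v) = Sh.cons lam (MvPolynomial.monomial t.exps (1 : k)) (word lam v) :=
      fun _ _ => rfl
    obtain ⟨z, hz⟩ := Sh.cons_pow_prime (MvPolynomial.aeval fun _ : X => (0 : k)) hp.out hlam
      (MvPolynomial.monomial s.exps (1 : k)) (word lam w)
    refine ⟨lam ^ (p - 1) * c, lam ^ (p - 1) •
      Sh.cons lam (MvPolynomial.monomial s.exps (1 : k) ^ p) y + z, (hlam.pow _).mul hc, ?_⟩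
    have h1 : MvPolynomial.monomial s.exps (1 : k) ^ p =
        MvPolynomial.monomial (FreeAbSemigroup.primePow p s).exps 1 := by
      rw [MvPolynomial.monomial_pow, one_pow]; rfl
    have h2 : wordPow p (s :: w) = FreeAbSemigroup.primePow p s :: wordPow p w := rfl
    rw [hcons, hz, h, h2, hcons, h1, map_add, map_smul, map_smul,
      smul_add, smul_smul, smul_add, smul_comm (p : k), add_assoc]

end Frobenius

/-! ### The canonical map -/

section Canonical

open FreeAbSemigroup

variable (k : Type*) [CommRing k] (lam : k) (X : Type*)

/-- The linear projection of the polynomial algebra onto the semigroup algebra that discards the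
constant term. -/
def dropConst : MvPolynomial X k →ₗ[k] MonoidAlgebra k (FreeAbSemigroup X) :=
  open Classical in
  (MvPolynomial.basisMonomials X k).constr k fun m =>
    if h : m = 0 then 0 else MonoidAlgebra.single ⟨m, h⟩ 1

variable {k X}

theorem incl_single (s : FreeAbSemigroup X) (r : k) :
    incl k X (MonoidAlgebra.single s r) = MvPolynomial.monomial s.exps r := by
  simp [incl, MvPolynomial.smul_monomial]

theorem dropConst_incl (x : MonoidAlgebra k (FreeAbSemigroup X)) :
    dropConst k X (incl k X x) = x := by
  induction x using MonoidAlgebra.induction_linear with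
  | zero => simp
  | add f g hf hg => rw [map_add, map_add, hf, hg]
  | single s r =>
    have h : MvPolynomial.monomial s.exps r = r • MvPolynomial.basisMonomials X k s.exps := by
      simp [MvPolynomial.smul_monomial]
    rw [incl_single, h, map_smul, dropConst, Module.Basis.constr_basis, dif_neg s.ne_zero]
    simp

theorem mapLin_one {A B : Type*} [NonUnitalCommRing A] [Module k A] [IsScalarTower k A A]
    [SMulCommClass k A A] [NonUnitalCommRing B] [Module k B] [IsScalarTower k B B]
    [SMulCommClass k B B] (f : A →ₗ[k] B) :
    Sh.mapLin lam f (1 : Sh k lam A) = 1 :=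
  map_one (TensorAlgebra.lift k ((TensorAlgebra.ι k).comp f))

theorem map_cons {A B : Type*} [NonUnitalCommRing A] [Module k A] [IsScalarTower k A A]
    [SMulCommClass k A A] [NonUnitalCommRing B] [Module k B] [IsScalarTower k B B]
    [SMulCommClass k B B] (f : A →ₙₐ[k] B) (a : A) (u : Sh k lam A) :
    Sh.map lam f (Sh.cons lam a u) = Sh.cons lam (f a) (Sh.map lam f u) :=
  Sh.mapLin_cons lam (f : A →ₗ[k] B) a u

theorem mapLin_dropConst_map (x : Sh k lam (MonoidAlgebra k (FreeAbSemigroup X))) :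
    Sh.mapLin lam (dropConst k X) (Sh.map lam (incl k X) x) = x := by
  induction x using Sh.induction with
  | one => rw [map_one, mapLin_one]
  | cons a u ih => rw [map_cons, Sh.mapLin_cons, ih, dropConst_incl]
  | add u v hu hv => rw [map_add, map_add, hu, hv]
  | smul r u hu => rw [map_smul, map_smul, hu]

theorem map_incl_wd (w : List (FreeAbSemigroup X)) :
    Sh.map lam (incl k X) (wd k lam w) = word lam w := by
  induction w with
  | nil => exact map_one (Sh.map lam (incl k X))
  | cons s w ih => rw [wd_cons, map_cons, ih, incl_single]; rfl

variable (k X) in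
theorem canonicalMap_injective : Function.Injective (canonicalMap k lam X) := by
  refine Function.LeftInverse.injective
    (g := TensorProduct.map LinearMap.id (Sh.mapLin lam (dropConst k X))) fun x => ?_
  induction x using TensorProduct.induction_on with
  | zero => simp
  | tmul a u => simp [canonicalMap, mapLin_dropConst_map]
  | add x y hx hy => rw [map_add, map_add, hx, hy]

variable {lam} in
/-- The `p`-th power of a word is, up to a unit and modulo `p`, the word of the `p`-th powers. -/
theorem wd_pow_prime (p : ℕ) [hp : Fact p.Prime] (hlam : IsUnit lam)
    (w : List (FreeAbSemigroup X)) :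
    ∃ (c : k) (y : Sh k lam (MonoidAlgebra k (FreeAbSemigroup X))), IsUnit c ∧
      wd k lam w ^ p = c • wd k lam (wordPow p w) + (p : k) • y := by
  obtain ⟨c, y, hc, h⟩ := word_pow_prime (k := k) p hlam w
  refine ⟨c, Sh.mapLin lam (dropConst k X) y, hc, ?_⟩
  rw [← mapLin_dropConst_map lam (wd k lam w ^ p), map_pow, map_incl_wd, h, map_add, map_smul,
    map_smul, ← map_incl_wd, mapLin_dropConst_map]

end Canonical

/-! ### Word powers and Lyndon words -/

section WordPow

open FreeAbSemigroup

variable {X : Type*}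

/-- The total degree of a monomial. -/
def deg (s : FreeAbSemigroup X) : ℕ := s.exps.degree

theorem deg_mul (s t : FreeAbSemigroup X) : deg (s * t) = deg s + deg t := by
  rw [deg, exps_mul, map_add, deg, deg]

theorem deg_pos (s : FreeAbSemigroup X) : 0 < deg s :=
  Nat.pos_of_ne_zero fun h => s.ne_zero ((Finsupp.degree_eq_zero_iff _).mp h)

variable (p : ℕ) [hp : Fact p.Prime]

theorem deg_primePow (s : FreeAbSemigroup X) : deg (primePow p s) = p * deg s := by
  rw [deg, primePow, map_nsmul, smul_eq_mul, deg]

theorem wordDeg_wordPow (w : List (FreeAbSemigroup X)) :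
    wordDeg deg (wordPow p w) = p * wordDeg deg w := by
  induction w with
  | nil => simp [wordPow]
  | cons s w ih =>
    have h : wordPow p (s :: w) = primePow p s :: wordPow p w := rfl
    rw [h, wordDeg_cons, wordDeg_cons, ih, deg_primePow, mul_add]

theorem wordDeg_pos {w : List (FreeAbSemigroup X)} (hw : w ≠ []) : 0 < wordDeg deg w := by
  obtain ⟨s, w, rfl⟩ := List.exists_cons_of_ne_nil hw
  rw [wordDeg_cons]
  exact Nat.add_pos_left (deg_pos s) _

theorem wordPow_ne_self {w : List (FreeAbSemigroup X)} (hw : w ≠ []) : w ≠ wordPow p w := by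
  intro h
  have h1 := congrArg (wordDeg deg) h
  rw [wordDeg_wordPow] at h1
  have h2 := wordDeg_pos hw
  have h3 := hp.out.two_le
  nlinarith

theorem primePow_injective : Function.Injective (primePow p : FreeAbSemigroup X → _) := by
  intro s t h
  have h1 : p • s.exps = p • t.exps := congrArg exps h
  refine exps_injective (Finsupp.ext fun x => ?_)
  have h2 := DFunLike.congr_fun h1 x
  simpa [hp.out.ne_zero] using h2

theorem wordPow_injective : Function.Injective (wordPow p (X := X)) :=
  List.map_injective_iff.mpr (primePow_injective p)

theorem finite_wordDeg_le [Finite X] (d : ℕ) :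
    {w : List (FreeAbSemigroup X) | wordDeg deg w ≤ d}.Finite := by
  have h1 : {s : FreeAbSemigroup X | deg s ≤ d}.Finite :=
    (Finsupp.finite_of_degree_le (σ := X) d).preimage exps_injective.injOn
  have : Finite {s : FreeAbSemigroup X // deg s ≤ d} := h1.to_subtype
  refine ((List.finite_length_le {s : FreeAbSemigroup X // deg s ≤ d} d).image
    (List.map Subtype.val)).subset fun w hw => ?_
  have h2 : ∀ w : List (FreeAbSemigroup X), wordDeg deg w ≤ d →
      w.length ≤ wordDeg deg w ∧ ∀ s ∈ w, deg s ≤ d := by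
    intro w
    induction w with
    | nil => simp
    | cons s w ih =>
      intro h
      rw [wordDeg_cons] at h ⊢
      have h3 := ih (by omega)
      have h4 := deg_pos s
      refine ⟨by rw [List.length_cons]; omega, fun t ht => ?_⟩
      rcases List.mem_cons.mp ht with rfl | ht
      · omega
      · exact h3.2 t ht
  obtain ⟨h3, h4⟩ := h2 w hw
  exact ⟨w.attachWith (fun s => deg s ≤ d) h4,
    List.length_attachWith.le.trans (h3.trans hw), by
      simpa only [List.map_id, id] using List.attachWith_map_val (f := id) h4⟩

variable [LinearOrder X]

theorem primePow_strictMono : StrictMono (primePow p : FreeAbSemigroup X → _) := by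
  intro s t h
  have h1 : toDegLex s.exps < toDegLex t.exps := h
  exact (nsmul_right_strictMono hp.out.ne_zero h1 : p • toDegLex s.exps < p • toDegLex t.exps)

theorem lt_primePow (s : FreeAbSemigroup X) : s < primePow p s := by
  have h : toDegLex s.exps < toDegLex (primePow p s).exps := by
    refine Finsupp.DegLex.lt_iff.mpr (Or.inl ?_)
    change deg s < deg (primePow p s)
    rw [deg_primePow]
    have h2 := deg_pos s
    have h3 := hp.out.two_le
    nlinarith
  exact h

theorem lex_map {α β : Type*} [LT α] [LT β] {g : α → β} (hg : ∀ a b, a < b → g a < g b)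
    {u v : List α} (h : List.Lex (· < ·) u v) : List.Lex (· < ·) (u.map g) (v.map g) := by
  induction h with
  | nil => exact List.Lex.nil
  | rel h => exact List.Lex.rel (hg _ _ h)
  | cons _ ih => exact List.Lex.cons ih

theorem IsLyndon.wordPow {w : List (FreeAbSemigroup X)} (hw : IsLyndon w) :
    IsLyndon (wordPow p w) := by
  refine ⟨by simpa [MixSh.wordPow] using hw.1, fun u v hu hv h => ?_⟩
  obtain ⟨u', v', rfl, rfl, rfl⟩ := List.map_eq_append_iff.mp h
  exact lex_map (fun _ _ h => primePow_strictMono p h)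
    (hw.2 u' v' (by simpa using hu) (by simpa using hv) rfl)

theorem shortlex_wordPow {w : List (FreeAbSemigroup X)} (hw : w ≠ []) :
    List.Shortlex (· < ·) w (wordPow p w) := by
  obtain ⟨s, w, rfl⟩ := List.exists_cons_of_ne_nil hw
  exact List.Shortlex.of_lex (by simp [wordPow]) (List.Lex.rel (lt_primePow p s))

theorem wellFounded_shortlex [Finite X] :
    WellFounded (List.Shortlex ((· < ·) : FreeAbSemigroup X → FreeAbSemigroup X → Prop)) := by
  have h : WellFounded ((· < ·) : FreeAbSemigroup X → FreeAbSemigroup X → Prop) :=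
    InvImage.wf (fun s : FreeAbSemigroup X => toDegLex s.exps)
      (wellFounded_lt (α := DegLex (X →₀ ℕ)))
  exact List.Shortlex.wf h

theorem mem_EL_or_exists_wordPow {l : List (FreeAbSemigroup X)} (hl : IsLyndon l) :
    l ∈ EL p X ∨ ∃ u, l = wordPow p u := by
  by_cases h : ∃ u, l = wordPow p u
  · exact Or.inr h
  · exact Or.inl ⟨hl, Or.inr (not_exists.mp h)⟩

theorem ne_wordPow_of_mem_EL {l : List (FreeAbSemigroup X)} (hl : l ∈ EL p X)
    (u : List (FreeAbSemigroup X)) : l ≠ wordPow p u :=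
  hl.2.elim (fun h => absurd h (wordPow_ne_self p hl.1.1)) (fun h => h u)

theorem wordPow_iterate_inj {u v : List (FreeAbSemigroup X)} (hu : u ∈ EL p X) (hv : v ∈ EL p X)
    {i j : ℕ} (h : (wordPow p)^[i] u = (wordPow p)^[j] v) : i = j ∧ u = v := by
  induction i generalizing j with
  | zero =>
    cases j with
    | zero => exact ⟨rfl, h⟩
    | succ j =>
      rw [Function.iterate_succ_apply'] at h
      exact absurd h (ne_wordPow_of_mem_EL p hu _)
  | succ i ih =>
    cases j with
    | zero =>
      rw [Function.iterate_succ_apply'] at h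
      exact absurd h.symm (ne_wordPow_of_mem_EL p hv _)
    | succ j =>
      rw [Function.iterate_succ_apply', Function.iterate_succ_apply'] at h
      obtain ⟨rfl, h'⟩ := ih (wordPow_injective p h)
      exact ⟨rfl, h'⟩

/-- The Lyndon word `u ^ ⟨p ^ i⟩` attached to the tensor power `u ⊗ ⋯ ⊗ u` with `p ^ i` factors of
an element `u` of `EL p X`; it has the same degree. -/
def telLyndon (w : TEL p X) : List (FreeAbSemigroup X) :=
  (wordPow p)^[w.2.choose_spec.2.choose] w.2.choose

theorem isLyndon_telLyndon (w : TEL p X) : IsLyndon (telLyndon p w) := by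
  have h : ∀ i : ℕ, IsLyndon ((wordPow p)^[i] w.2.choose) := by
    intro i
    induction i with
    | zero => exact w.2.choose_spec.1.1
    | succ i ih => rw [Function.iterate_succ_apply']; exact ih.wordPow p
  exact h _

theorem wordDeg_telLyndon (w : TEL p X) : wordDeg deg (telLyndon p w) = wordDeg deg w.1 := by
  have h : ∀ (u : List (FreeAbSemigroup X)) (i : ℕ),
      wordDeg deg ((wordPow p)^[i] u) = p ^ i * wordDeg deg u := by
    intro u i
    induction i with
    | zero => simp
    | succ i ih => rw [Function.iterate_succ_apply', wordDeg_wordPow, ih, pow_succ']; ring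
  rw [telLyndon, h]
  conv_rhs => rw [w.2.choose_spec.2.choose_spec, wordDeg_flatten]
  simp

theorem telLyndon_injective : Function.Injective (telLyndon p (X := X)) := by
  intro w w' h
  obtain ⟨h1, h2⟩ := wordPow_iterate_inj p w.2.choose_spec.1 w'.2.choose_spec.1 h
  refine Subtype.ext ?_
  rw [w.2.choose_spec.2.choose_spec, w'.2.choose_spec.2.choose_spec, h1, h2]

/-- The word attached to a monomial in the elements of `TEL p X`: the concatenation in
non-increasing order of the Lyndon words attached to the variables. -/
def monomialWord (m : TEL p X →₀ ℕ) : List (FreeAbSemigroup X) :=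
  assemble ((Finsupp.toMultiset m).map (telLyndon p))

theorem monomialWord_injective : Function.Injective (monomialWord p (X := X)) := by
  intro m m' h
  have h1 := congrArg factors h
  have h2 : ∀ m : TEL p X →₀ ℕ, ∀ l ∈ (Finsupp.toMultiset m).map (telLyndon p), IsLyndon l := by
    intro m l hl
    obtain ⟨w, -, rfl⟩ := Multiset.mem_map.mp hl
    exact isLyndon_telLyndon p w
  rw [monomialWord, monomialWord, factors_assemble (h2 m), factors_assemble (h2 m')] at h1
  exact Multiset.toFinsupp.symm.injective (Multiset.map_injective (telLyndon_injective p) h1)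

/-- The degree of a monomial in the elements of `TEL p X`, each of them having its degree as a
word. -/
def telDeg : (TEL p X →₀ ℕ) →+ ℕ := Finsupp.weight fun w : TEL p X => wordDeg deg w.1

theorem wordDeg_monomialWord (m : TEL p X →₀ ℕ) :
    wordDeg deg (monomialWord p m) = telDeg p m := by
  rw [monomialWord, wordDeg_assemble, Multiset.map_map]
  induction m using Finsupp.induction_linear with
  | zero => simp
  | add f g hf hg => rw [map_add, map_add, Multiset.map_add, Multiset.sum_add, hf, hg]
  | single w n =>
    rw [telDeg, Finsupp.weight_single]
    simp [Finsupp.toMultiset_single, Multiset.map_nsmul, Multiset.sum_nsmul, wordDeg_telLyndon]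

end WordPow

/-- If `p ^ i` is the largest power of `p` up to `n`, then `n.choose (p ^ i)` is prime to `p`; by
Lucas' theorem it is congruent to the leading digit of `n` in base `p`. -/
theorem not_dvd_choose_pow {p : ℕ} [hp : Fact p.Prime] (i n : ℕ) (h1 : p ^ i ≤ n)
    (h2 : n < p ^ (i + 1)) : ¬ p ∣ n.choose (p ^ i) := by
  induction i generalizing n with
  | zero =>
    rw [pow_zero, Nat.choose_one_right]
    exact Nat.not_dvd_of_pos_of_lt (by rwa [pow_zero] at h1) (by simpa using h2)
  | succ i ih =>
    have hpos := hp.out.pos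
    have h3 := Choose.choose_modEq_choose_mod_mul_choose_div_nat (p := p) (n := n)
      (k := p ^ (i + 1))
    rw [pow_succ, Nat.mul_mod_left, Nat.choose_zero_right, one_mul, Nat.mul_div_cancel _ hpos] at h3
    rw [pow_succ, h3.dvd_iff dvd_rfl]
    refine ih _ ?_ ?_
    · rw [Nat.le_div_iff_mul_le hpos]
      rwa [pow_succ] at h1
    · rw [Nat.div_lt_iff_lt_mul hpos]
      rwa [pow_succ] at h2

/-! ### Generation modulo `p` -/

section Filtration

variable (k : Type*) [CommRing k] (lam : k) (X : Type*)

/-- The span of the words of degree at most `d`. -/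
def shFil (d : ℕ) : Submodule k (Sh k lam (MonoidAlgebra k (FreeAbSemigroup X))) :=
  wdSpan k lam {w | wordDeg deg w ≤ d}

variable {k lam X}

theorem shFil_mono {d e : ℕ} (h : d ≤ e) : shFil k lam X d ≤ shFil k lam X e :=
  wdSpan_mono fun w (hw : wordDeg deg w ≤ d) => hw.trans h

/-- The product of elements of degrees at most `d` and `e` has degree at most `d + e`. The class
`SetLike.GradedMonoid` asks for no directness of the sum, so that it applies to filtrations. -/
instance : SetLike.GradedMonoid (shFil k lam X) where
  one_mem := wd_mem_wdSpan (w := []) (by simp)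
  mul_mem d e f g hf hg := by
    induction hf using Submodule.span_induction with
    | zero => rw [zero_mul]; exact zero_mem _
    | add x y _ _ hx hy => rw [add_mul]; exact add_mem hx hy
    | smul r x _ hx =>
      have h : (r • x) * g = r • (x * g) := smul_mul_assoc r x g
      rw [h]
      exact Submodule.smul_mem _ _ hx
    | mem x hx =>
      obtain ⟨u, hu, rfl⟩ := hx
      induction hg using Submodule.span_induction with
      | zero => rw [mul_zero]; exact zero_mem _
      | add x y _ _ hx hy => rw [mul_add]; exact add_mem hx hy
      | smul r x _ hx =>
        have h : wd k lam u * (r • x) = r • (wd k lam u * x) := mul_smul_comm r _ x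
        rw [h]
        exact Submodule.smul_mem _ _ hx
      | mem y hy =>
        obtain ⟨v, hv, rfl⟩ := hy
        refine wdSpan_mono ?_ (wd_mul_wd_mem deg_mul u v)
        rintro z ⟨-, hz⟩
        exact hz.trans_le (add_le_add hu hv)

end Filtration

section Generation

variable (p : ℕ) [hp : Fact p.Prime] (k : Type*) [CommRing k] (lam : k)
  (X : Type*) [LinearOrder X]

/-- The homomorphism from the polynomial algebra on `TEL p X` to the mixable shuffle algebra that
sends every variable to the corresponding word. -/
def telHom : MvPolynomial (TEL p X) k →ₐ[k] Sh k lam (MonoidAlgebra k (FreeAbSemigroup X)) :=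
  MvPolynomial.aeval fun w : TEL p X => wd k lam w.1

theorem telHom_X (w : TEL p X) : telHom p k lam X (MvPolynomial.X w) = wd k lam w.1 := by
  rw [telHom, MvPolynomial.aeval_X]

/-- The span of the monomials of degree at most `d`. -/
def polyFil (d : ℕ) : Submodule k (MvPolynomial (TEL p X) k) :=
  Submodule.span k ((fun m => MvPolynomial.monomial m (1 : k)) '' {m | telDeg p m ≤ d})

/-- The elements which modulo `p` are the value of a polynomial of degree at most `d`. -/
def genFil (d : ℕ) : Submodule k (Sh k lam (MonoidAlgebra k (FreeAbSemigroup X))) :=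
  (polyFil p k X d).map (telHom p k lam X).toLinearMap ⊔
    LinearMap.range (LinearMap.lsmul k (Sh k lam (MonoidAlgebra k (FreeAbSemigroup X))) (p : k))

variable {k lam X}

theorem mem_genFil {d : ℕ} {x : Sh k lam (MonoidAlgebra k (FreeAbSemigroup X))} :
    x ∈ genFil p k lam X d ↔
      ∃ q ∈ polyFil p k X d, ∃ y, x = telHom p k lam X q + (p : k) • y := by
  rw [genFil, Submodule.mem_sup]
  constructor
  · rintro ⟨_, ⟨q, hq, rfl⟩, _, ⟨y, rfl⟩, rfl⟩
    exact ⟨q, hq, y, rfl⟩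
  · rintro ⟨q, hq, y, rfl⟩
    exact ⟨_, ⟨q, hq, rfl⟩, _, ⟨y, rfl⟩, rfl⟩

theorem monomial_mem_polyFil {d : ℕ} {m : TEL p X →₀ ℕ} (h : telDeg p m ≤ d) :
    MvPolynomial.monomial m (1 : k) ∈ polyFil p k X d :=
  Submodule.subset_span ⟨m, h, rfl⟩

theorem polyFil_mono {d e : ℕ} (h : d ≤ e) : polyFil p k X d ≤ polyFil p k X e :=
  Submodule.span_mono (Set.image_mono fun _ hm => le_trans hm h)

theorem genFil_mono {d e : ℕ} (h : d ≤ e) : genFil p k lam X d ≤ genFil p k lam X e :=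
  sup_le_sup_right (Submodule.map_mono (polyFil_mono p h)) _

instance : SetLike.GradedMonoid (polyFil p k X) where
  one_mem := monomial_mem_polyFil p (m := 0) (by simp)
  mul_mem d e f g hf hg := by
    have h := Submodule.mul_mem_mul hf hg
    rw [polyFil, polyFil, Submodule.span_mul_span] at h
    refine Submodule.span_mono ?_ h
    rintro _ ⟨_, ⟨m, hm, rfl⟩, _, ⟨n, hn, rfl⟩, rfl⟩
    refine ⟨m + n, ?_, by simp [MvPolynomial.monomial_mul]⟩
    have hm' : telDeg p m ≤ d := hm
    have hn' : telDeg p n ≤ e := hn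
    change telDeg p (m + n) ≤ d + e
    rw [map_add]
    exact add_le_add hm' hn'

instance : SetLike.GradedMonoid (genFil p k lam X) where
  one_mem := (mem_genFil p).mpr ⟨1, SetLike.one_mem_graded (polyFil p k X), 0, by simp⟩
  mul_mem d e f g hf hg := by
    obtain ⟨q, hq, y, rfl⟩ := (mem_genFil p).mp hf
    obtain ⟨r, hr, z, rfl⟩ := (mem_genFil p).mp hg
    refine (mem_genFil p).mpr ⟨q * r, SetLike.mul_mem_graded hq hr,
      telHom p k lam X q * z + y * telHom p k lam X r + (p : k) • (y * z), ?_⟩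
    simp only [map_mul, mul_add, add_mul, smul_mul_assoc, mul_smul_comm, smul_add]
    abel

theorem telHom_mem_shFil {d : ℕ} {f : MvPolynomial (TEL p X) k} (hf : f ∈ polyFil p k X d) :
    telHom p k lam X f ∈ shFil k lam X d := by
  have key : ∀ m : TEL p X →₀ ℕ,
      telHom p k lam X (MvPolynomial.monomial m 1) ∈ shFil k lam X (telDeg p m) := by
    intro m
    induction m using Finsupp.induction_linear with
    | zero => simpa using SetLike.one_mem_graded (shFil k lam X)
    | add m n hm hn =>
      have h : MvPolynomial.monomial (m + n) (1 : k) =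
          MvPolynomial.monomial m 1 * MvPolynomial.monomial n 1 := by
        simp [MvPolynomial.monomial_mul]
      rw [h, map_mul, map_add]
      exact SetLike.mul_mem_graded hm hn
    | single w n =>
      rw [← MvPolynomial.X_pow_eq_monomial, map_pow, telHom_X, telDeg, Finsupp.weight_single]
      have h : wd k lam w.1 ∈ shFil k lam X (wordDeg deg w.1) :=
        wd_mem_wdSpan (le_refl (wordDeg deg w.1))
      exact SetLike.pow_mem_graded n h
  induction hf using Submodule.span_induction with
  | zero => rw [map_zero]; exact zero_mem _
  | add x y _ _ hx hy => rw [map_add]; exact add_mem hx hy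
  | smul r x _ hx => rw [map_smul]; exact Submodule.smul_mem _ _ hx
  | mem x hx =>
    obtain ⟨m, hm, rfl⟩ := hx
    exact shFil_mono hm (key m)

/-- If the Lyndon factors of `w` can be divided into two non-empty parts in such a way that the
multiplicity of `w` in the product of the two parts is a unit, then `w` is generated modulo
`p` by smaller words. -/
theorem wd_mem_genFil_of_split {w : List (FreeAbSemigroup X)} {s t : Multiset _}
    (hst : factors w = s + t) (hs : s ≠ 0) (ht : t ≠ 0) (hc : IsUnit (shuffleCoeff s t : k))
    (ih : ∀ z : List (FreeAbSemigroup X), List.Shortlex (· < ·) z w →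
      wd k lam z ∈ genFil p k lam X (wordDeg deg z)) :
    wd k lam w ∈ genFil p k lam X (wordDeg deg w) := by
  have hl : ∀ l ∈ s + t, IsLyndon l := fun l h => isLyndon_of_mem_factors (hst ▸ h)
  have fs : factors (assemble s) = s :=
    factors_assemble fun l h => hl l (Multiset.mem_add.mpr (Or.inl h))
  have ft : factors (assemble t) = t :=
    factors_assemble fun l h => hl l (Multiset.mem_add.mpr (Or.inr h))
  have htop : topShuffle (assemble s) (assemble t) = w := by
    rw [topShuffle, fs, ft, ← hst, assemble_factors]
  have hlen := length_topShuffle (assemble s) (assemble t)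
  have hdeg := wordDeg_topShuffle deg (assemble s) (assemble t)
  have hs' : 0 < (assemble s).length := by
    refine List.length_pos_iff.mpr fun h => hs ?_
    rw [← fs, h, factors_nil]
  have ht' : 0 < (assemble t).length := by
    refine List.length_pos_iff.mpr fun h => ht ?_
    rw [← ft, h, factors_nil]
  have h := wd_mul_wd_sub_mem (k := k) (lam := lam) deg_mul (assemble s) (assemble t)
  rw [htop] at h hlen hdeg
  have h1 := SetLike.mul_mem_graded (ih (assemble s) (List.Shortlex.of_length_lt (by omega)))
    (ih (assemble t) (List.Shortlex.of_length_lt (by omega)))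
  have h2 : wdSpan k lam (lowerWords deg w) ≤ genFil p k lam X (wordDeg deg w) := by
    refine Submodule.span_le.mpr ?_
    rintro _ ⟨z, ⟨hz, hz'⟩, rfl⟩
    rw [← hz']
    exact ih z hz
  rw [← hdeg] at h1
  have h3 := sub_mem h1 (h2 h)
  rw [sub_sub_cancel, topCoeff, fs, ft] at h3
  exact (Submodule.smul_mem_iff_of_isUnit _ hc).mp h3

variable [IsLocalRing k]

theorem isUnit_natCast_of_not_dvd (hpk : (p : k) ∈ IsLocalRing.maximalIdeal k) {n : ℕ}
    (hn : ¬ p ∣ n) : IsUnit (n : k) := by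
  by_contra h
  have h1 : (n : k) ∈ IsLocalRing.maximalIdeal k := h
  have h2 : IsCoprime (p : ℤ) (n : ℤ) :=
    Nat.isCoprime_iff_coprime.mpr ((Nat.Prime.coprime_iff_not_dvd hp.out).mpr hn)
  obtain ⟨a, b, hab⟩ := h2
  have h3 := congrArg (Int.cast : ℤ → k) hab
  push_cast at h3
  refine (Ideal.ne_top_iff_one _).mp (IsLocalRing.maximalIdeal.isMaximal k).ne_top ?_
  rw [← h3]
  exact add_mem (Ideal.mul_mem_left _ _ hpk) (Ideal.mul_mem_left _ _ h1)

/-- Every word is generated modulo `p` by the words of `TEL p X`. The induction splits off Lyndon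
factors until a tensor power `l ⊗ ⋯ ⊗ l` of a Lyndon word with `p ^ i` factors is left; this
belongs to `TEL p X`, or it is modulo `p` the `p`-th power of a smaller word. -/
theorem wd_mem_genFil [Finite X] (hlam : IsUnit lam)
    (hpk : (p : k) ∈ IsLocalRing.maximalIdeal k) (w : List (FreeAbSemigroup X)) :
    wd k lam w ∈ genFil p k lam X (wordDeg deg w) := by
  refine wellFounded_shortlex.induction
    (C := fun w => wd k lam w ∈ genFil p k lam X (wordDeg deg w)) w fun w ih => ?_
  rcases (factors w).empty_or_exists_mem with h0 | ⟨l, hl⟩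
  · rw [← assemble_factors w, h0, assemble_zero, wd_nil]
    exact SetLike.one_mem_graded (genFil p k lam X)
  have hlyn := isLyndon_of_mem_factors hl
  by_cases hall : ∀ l' ∈ factors w, l' = l
  · have hrep := Multiset.eq_replicate_card.mpr hall
    set n := Multiset.card (factors w) with hn
    have hn0 : n ≠ 0 := by
      rw [hn, Ne, Multiset.card_eq_zero]
      rintro h
      simp [h] at hl
    have hle := Nat.pow_log_le_self p hn0
    have hlt := Nat.lt_pow_succ_log_self hp.out.one_lt n
    rcases hle.lt_or_eq with hlt' | heq
    · obtain ⟨m, hm⟩ := Nat.exists_eq_add_of_lt hlt'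
      refine wd_mem_genFil_of_split p (s := Multiset.replicate (p ^ Nat.log p n) l)
        (t := Multiset.replicate (m + 1) l) ?_ ?_ ?_ ?_ ih
      · rw [← Multiset.replicate_add, ← add_assoc, ← hm]
        exact hrep
      · rw [← Multiset.card_pos, Multiset.card_replicate]
        exact pow_pos hp.out.pos _
      · rw [← Multiset.card_pos, Multiset.card_replicate]
        exact Nat.succ_pos m
      · rw [shuffleCoeff_replicate, ← add_assoc, ← hm]
        exact isUnit_natCast_of_not_dvd p hpk (not_dvd_choose_pow _ n hle hlt)
    · have hw : w = (List.replicate (p ^ Nat.log p n) l).flatten := by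
        rw [heq, ← assemble_replicate, ← hrep, assemble_factors]
      rcases mem_EL_or_exists_wordPow p hlyn with hEL | ⟨u, hu⟩
      · have hT : w ∈ TEL p X := ⟨l, hEL, _, hw⟩
        refine (mem_genFil p).mpr ⟨MvPolynomial.X ⟨w, hT⟩, monomial_mem_polyFil p ?_, 0, ?_⟩
        · rw [telDeg, Finsupp.weight_single, one_smul]
        · rw [telHom_X, smul_zero, add_zero]
      · set v := (List.replicate (p ^ Nat.log p n) u).flatten with hv
        have hwv : w = wordPow p v := by
          rw [hw, hu, hv, wordPow, wordPow, List.map_flatten, List.map_replicate]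
        have hv0 : v ≠ [] := by
          rintro h
          have h1 : w = [] := by rw [hwv, h]; rfl
          rw [h1, factors_nil] at hl
          simp at hl
        have h1 := SetLike.pow_mem_graded p (ih v (hwv ▸ shortlex_wordPow p hv0))
        obtain ⟨c, y, hc, hy⟩ := wd_pow_prime (k := k) p hlam v
        rw [hy, ← hwv, smul_eq_mul, ← wordDeg_wordPow, ← hwv] at h1
        have h2 : (p : k) • y ∈ genFil p k lam X (wordDeg deg w) :=
          (mem_genFil p).mpr ⟨0, zero_mem _, y, by simp⟩
        have h3 := sub_mem h1 h2
        rw [add_sub_cancel_right] at h3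
        exact (Submodule.smul_mem_iff_of_isUnit _ hc).mp h3
  · refine wd_mem_genFil_of_split p (s := (factors w).filter (· = l))
      (t := (factors w).filter (¬ · = l)) (Multiset.filter_add_not _ _).symm ?_ ?_ ?_ ih
    · intro h
      have : l ∈ (factors w).filter (· = l) := Multiset.mem_filter.mpr ⟨hl, rfl⟩
      simp [h] at this
    · intro h
      push Not at hall
      obtain ⟨l', hl', hne⟩ := hall
      have : l' ∈ (factors w).filter (¬ · = l) := Multiset.mem_filter.mpr ⟨hl', hne⟩
      simp [h] at this
    · rw [shuffleCoeff_eq_one_of_disjoint, Nat.cast_one]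
      · exact isUnit_one
      · refine Multiset.disjoint_left.mpr fun {x} hx hx' => ?_
        exact (Multiset.mem_filter.mp hx').2 (Multiset.mem_filter.mp hx).2

/-! ### The polynomial presentation -/

/-- By Nakayama's lemma, generation modulo `p` in the finitely generated module of elements of
degree at most `d` implies generation. -/
theorem shFil_le_map [Finite X] (hlam : IsUnit lam) (hpk : (p : k) ∈ IsLocalRing.maximalIdeal k)
    (d : ℕ) :
    shFil k lam X d ≤ (polyFil p k X d).map (telHom p k lam X).toLinearMap := by
  have hfg : (shFil k lam X d).FG :=
    Submodule.fg_span ((finite_wordDeg_le d).image _)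
  refine Submodule.le_of_le_smul_of_le_jacobson_bot (I := IsLocalRing.maximalIdeal k) hfg
    (IsLocalRing.maximalIdeal_le_jacobson _) ?_
  -- the projection onto the words of degree at most `d`
  let π : Sh k lam (MonoidAlgebra k (FreeAbSemigroup X)) →ₗ[k] _ :=
    (wdBasis k lam (FreeAbSemigroup X)).constr k
      fun w => if wordDeg deg w ≤ d then wd k lam w else 0
  have hπw : ∀ w, π (wd k lam w) = if wordDeg deg w ≤ d then wd k lam w else 0 := fun w =>
    (congrArg π (wdBasis_apply w).symm).trans (Module.Basis.constr_basis _ _ _ _)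
  have hπ : ∀ x ∈ shFil k lam X d, π x = x := by
    intro x hx
    have h : shFil k lam X d ≤ LinearMap.eqLocus π LinearMap.id := by
      refine Submodule.span_le.mpr ?_
      rintro _ ⟨w, hw, rfl⟩
      exact (hπw w).trans (if_pos hw)
    exact h hx
  have hπ' : ∀ x, π x ∈ shFil k lam X d := by
    intro x
    have h : (⊤ : Submodule k (Sh k lam (MonoidAlgebra k (FreeAbSemigroup X)))) ≤
        (shFil k lam X d).comap π := by
      rw [← wdSpan_univ]
      refine Submodule.span_le.mpr ?_
      rintro _ ⟨w, -, rfl⟩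
      change π (wd k lam w) ∈ shFil k lam X d
      rw [hπw]
      split_ifs with hw
      · exact wd_mem_wdSpan hw
      · exact zero_mem _
    exact h trivial
  refine Submodule.span_le.mpr ?_
  rintro _ ⟨w, hw, rfl⟩
  obtain ⟨q, hq, y, hy⟩ := (mem_genFil p).mp
    (genFil_mono p hw (wd_mem_genFil (lam := lam) p hlam hpk w))
  have h1 := congrArg π hy
  rw [map_add, map_smul, hπ _ (wd_mem_wdSpan hw), hπ _ (telHom_mem_shFil p hq)] at h1
  rw [h1]
  exact add_mem (Submodule.mem_sup_left ⟨q, hq, rfl⟩)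
    (Submodule.mem_sup_right (Submodule.smul_mem_smul hpk (hπ' y)))

theorem telHom_surjective [Finite X] (hlam : IsUnit lam)
    (hpk : (p : k) ∈ IsLocalRing.maximalIdeal k) : Function.Surjective (telHom p k lam X) := by
  intro x
  have h : (⊤ : Submodule k (Sh k lam (MonoidAlgebra k (FreeAbSemigroup X)))) ≤
      LinearMap.range (telHom p k lam X).toLinearMap := by
    rw [← wdSpan_univ]
    refine Submodule.span_le.mpr ?_
    rintro _ ⟨w, -, rfl⟩
    obtain ⟨q, -, hq⟩ := shFil_le_map (lam := lam) p hlam hpk (wordDeg deg w)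
      (wd_mem_wdSpan (le_refl (wordDeg deg w)))
    exact ⟨q, hq⟩
  exact h trivial

/-- There are no more monomials in the elements of `TEL p X` than words in every degree, so that
a surjection between the corresponding modules is injective. -/
theorem telHom_injective [Finite X] (hlam : IsUnit lam)
    (hpk : (p : k) ∈ IsLocalRing.maximalIdeal k) : Function.Injective (telHom p k lam X) := by
  let ι : MvPolynomial (TEL p X) k →ₗ[k] Sh k lam (MonoidAlgebra k (FreeAbSemigroup X)) :=
    (MvPolynomial.basisMonomials (TEL p X) k).constr k fun m => wd k lam (monomialWord p m)
  have hι : Function.Injective ι := by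
    have h : LinearIndependent k fun m : TEL p X →₀ ℕ => wd k lam (monomialWord p m) := by
      have h1 := (wdBasis k lam (FreeAbSemigroup X)).linearIndependent.comp _
        (monomialWord_injective p)
      convert h1 using 2 with m
      exact (wdBasis_apply _).symm
    have h2 : (ι : MvPolynomial (TEL p X) k → _) =
        Finsupp.linearCombination k (fun m : TEL p X →₀ ℕ => wd k lam (monomialWord p m)) ∘
          (MvPolynomial.basisMonomials (TEL p X) k).repr := by
      funext f
      exact Module.Basis.constr_apply _ _ _ _
    rw [h2]
    exact Function.Injective.comp h (LinearEquiv.injective _)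
  have hι' : ∀ d, ∀ f ∈ polyFil p k X d, ι f ∈ shFil k lam X d := by
    intro d f hf
    have h : polyFil p k X d ≤ (shFil k lam X d).comap ι := by
      refine Submodule.span_le.mpr ?_
      rintro _ ⟨m, hm, rfl⟩
      have h1 : ι (MvPolynomial.monomial m 1) = wd k lam (monomialWord p m) :=
        (congrArg ι (congrFun (MvPolynomial.coe_basisMonomials _ _) m).symm).trans
          (Module.Basis.constr_basis _ _ _ _)
      change ι (MvPolynomial.monomial m 1) ∈ shFil k lam X d
      rw [h1]
      exact wd_mem_wdSpan ((wordDeg_monomialWord p m).trans_le hm)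
    exact h hf
  rw [injective_iff_map_eq_zero]
  intro f hf
  -- restrict to the elements of degree at most `d`, where `d` is the degree of `f`
  set d := f.support.sup (telDeg p) with hd
  have hfd : f ∈ polyFil p k X d := by
    rw [f.as_sum]
    refine sum_mem fun m hm => ?_
    have h : MvPolynomial.monomial m (f.coeff m) = f.coeff m • MvPolynomial.monomial m (1 : k) := by
      rw [MvPolynomial.smul_monomial, smul_eq_mul, mul_one]
    rw [h]
    exact Submodule.smul_mem _ _ (monomial_mem_polyFil p (Finset.le_sup (f := telDeg p) hm))
  have hfin : Module.Finite k (shFil k lam X d) :=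
    Module.Finite.iff_fg.mpr (Submodule.fg_span ((finite_wordDeg_le d).image _))
  let i : polyFil p k X d →ₗ[k] shFil k lam X d := ι.restrict (hι' d)
  let g : polyFil p k X d →ₗ[k] shFil k lam X d :=
    (telHom p k lam X).toLinearMap.restrict fun _ hx => telHom_mem_shFil p hx
  have hi : Function.Injective i := fun a b hab => Subtype.ext (hι (congrArg Subtype.val hab))
  have hg : Function.Surjective g := by
    rintro ⟨x, hx⟩
    obtain ⟨q, hq, rfl⟩ := shFil_le_map p hlam hpk d hx
    exact ⟨⟨q, hq⟩, rfl⟩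
  have hinj := OrzechProperty.injective_of_surjective_of_injective i g hi hg
  have h0 : g ⟨f, hfd⟩ = g 0 := Subtype.ext (by rw [map_zero]; exact hf)
  exact congrArg Subtype.val (hinj h0)

end Generation

end MixSh

end

theorem mainTheorem12 (p : ℕ) [Fact p.Prime] (lam : ℤ_[p]) (hlam : IsUnit lam)
    (X : Type*) [Finite X] [LinearOrder X] :
    Function.Injective (MixSh.canonicalMap ℤ_[p] lam X) ∧
    ∃ e : MvPolynomial (X ⊕ MixSh.TEL p X) ℤ_[p] ≃ₐ[ℤ_[p]]
        MixSh.canonicalSubalgebra ℤ_[p] lam X,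
      (∀ x : X, (e (MvPolynomial.X (Sum.inl x)) : MixSh.Sha ℤ_[p] lam (MvPolynomial X ℤ_[p])) =
        MvPolynomial.X x ⊗ₜ[ℤ_[p]] 1) ∧
      (∀ w : MixSh.TEL p X,
        (e (MvPolynomial.X (Sum.inr w)) : MixSh.Sha ℤ_[p] lam (MvPolynomial X ℤ_[p])) =
        1 ⊗ₜ[ℤ_[p]] MixSh.word lam w.1) := by
  have hpk : (p : ℤ_[p]) ∈ IsLocalRing.maximalIdeal ℤ_[p] := by
    rw [PadicInt.maximalIdeal_eq_span_p]
    exact Ideal.mem_span_singleton_self _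
  have hinj := MixSh.canonicalMap_injective ℤ_[p] lam X
  refine ⟨hinj, ?_⟩
  let e₁ := AlgEquiv.ofBijective (MixSh.telHom p ℤ_[p] lam X)
    ⟨MixSh.telHom_injective p hlam hpk, MixSh.telHom_surjective p hlam hpk⟩
  let e₂ := (MvPolynomial.tensorEquivSum ℤ_[p] X (MixSh.TEL p X) ℤ_[p]).symm.trans
    (Algebra.TensorProduct.congr AlgEquiv.refl e₁)
  let e := e₂.trans (AlgEquiv.ofInjective _ hinj)
  have he : ∀ f, (e f : MixSh.Sha ℤ_[p] lam (MvPolynomial X ℤ_[p])) =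
      MixSh.canonicalMap ℤ_[p] lam X (e₂ f) := fun f => rfl
  refine ⟨e, fun x => (he _).trans ?_, fun w => (he _).trans ?_⟩
  · have h : e₂ (MvPolynomial.X (Sum.inl x)) = MvPolynomial.X x ⊗ₜ 1 := by
      simp only [e₂, AlgEquiv.trans_apply]
      rw [← MvPolynomial.tensorEquivSum_X_tmul_one (R := ℤ_[p]), AlgEquiv.symm_apply_apply]
      simp
    rw [h]
    simp [MixSh.canonicalMap]
  · have h : e₂ (MvPolynomial.X (Sum.inr w)) = 1 ⊗ₜ MixSh.wd ℤ_[p] lam w.1 := by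
      simp only [e₂, AlgEquiv.trans_apply]
      rw [← MvPolynomial.tensorEquivSum_one_tmul_X (R := ℤ_[p]), AlgEquiv.symm_apply_apply]
      rw [Algebra.TensorProduct.congr_apply, Algebra.TensorProduct.map_tmul]
      exact congrArg (fun y => (1 : MvPolynomial X ℤ_[p]) ⊗ₜ[ℤ_[p]] y)
        (MixSh.telHom_X p ℤ_[p] lam X w)
    rw [h]
    simp [MixSh.canonicalMap, MixSh.map_incl_wd]
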